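/- Let $n\ge 2$ be an integer and let $\omega_n$ be the $(n-1)$-dimensional measure of the unit sphere in $\mathbb{R}^n$. A density function is a measurable, compactly supported function $\rho:\mathbb{R}^n\to[0,1]$; put $$V_\rho(x)=\frac{n}{\omega_n}\int_{\mathbb{R}^n}\frac{\rho(\zeta)\,d\zeta}{|x-\zeta|^{n}} .$$ The initial value problem $\mathcal{M}'(t)=1-\mathcal{M}(t)^{2/n}$ for $t\ge 0$, $\mathcal{M}(0)=0$, has a solution on $[0,\infty)$; let $\mathcal{M}_n$ be any such solution. For a density function $\rho$ define $$F_\rho(x)=\begin{cases}\log \mathcal{M}_2(V_\rho(x)), & n=2,\\ \mathcal{M}_n(V_\rho(x))^{(n-2)/n}, & n\ge 3.\end{cases}$$ If $\rho$ is a density function (not almost everywhere zero in the case $n=2$), then $F_\rho$ is subharmonic in $\mathbb{R}^n\setminus\operatorname{supp}\rho$. Moreover, if $B$ is an open or closed Euclidean ball of positive radius and $\rho=\chi_B$ is its characteristic function, then $F_\rho$ is harmonic in $\mathbb{R}^n\setminus\overline{B}$. -/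

import Mathlib

open MeasureTheory Metric Set

noncomputable section

/-- A density function on `ℝⁿ`: (Lebesgue) measurable, compactly supported, with values
in `[0, 1]`. -/
structure IsDensity {n : ℕ} (ρ : EuclideanSpace ℝ (Fin n) → ℝ) : Prop where
  aemeasurable : AEMeasurable ρ volume
  nonneg : ∀ x, 0 ≤ ρ x
  le_one : ∀ x, ρ x ≤ 1
  hasCompactSupport : HasCompactSupport ρ

/-- `ω_n`, the `(n-1)`-dimensional surface measure of the unit sphere of `ℝⁿ`. -/
def sphereArea (n : ℕ) : ℝ :=
  (volume : Measure (EuclideanSpace ℝ (Fin n))).toSphere.real univ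

/-- The potential `V_ρ(x) = (n / ω_n) ∫ ρ(ζ) |x - ζ|^{-n} dζ`. -/
def potentialV {n : ℕ} (ρ : EuclideanSpace ℝ (Fin n) → ℝ) (x : EuclideanSpace ℝ (Fin n)) : ℝ :=
  (n : ℝ) / sphereArea n * ∫ ζ, ρ ζ / ‖x - ζ‖ ^ n

/-- `M` solves `M' = 1 - M^{2/n}`, `M(0) = 0` on `[0, ∞)` (one-sided derivative at `0`).
Values of `M` at negative arguments are irrelevant. -/
def IsProfile (n : ℕ) (M : ℝ → ℝ) : Prop :=
  M 0 = 0 ∧ ∀ t, 0 ≤ t → HasDerivWithinAt M (1 - M t ^ ((2 : ℝ) / n)) (Ici 0) t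

/-- `log M(V_ρ)` if `n = 2`, and `M(V_ρ)^{(n-2)/n}` otherwise. -/
def profileTransform {n : ℕ} (M : ℝ → ℝ) (ρ : EuclideanSpace ℝ (Fin n) → ℝ)
    (x : EuclideanSpace ℝ (Fin n)) : ℝ :=
  if n = 2 then Real.log (M (potentialV ρ x))
  else M (potentialV ρ x) ^ (((n : ℝ) - 2) / n)

/-- `u` is subharmonic on `U`: it is upper semicontinuous, and on every closed ball contained
in `U` it lies below each continuous function that is harmonic in the interior and dominates
`u` on the boundary sphere. -/
def SubharmonicOn {n : ℕ} (u : EuclideanSpace ℝ (Fin n) → ℝ)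
    (U : Set (EuclideanSpace ℝ (Fin n))) : Prop :=
  UpperSemicontinuousOn u U ∧
    ∀ (x : EuclideanSpace ℝ (Fin n)) (r : ℝ), 0 < r → closedBall x r ⊆ U →
      ∀ h : EuclideanSpace ℝ (Fin n) → ℝ, ContinuousOn h (closedBall x r) →
        InnerProductSpace.HarmonicOnNhd h (ball x r) →
        (∀ y ∈ sphere x r, u y ≤ h y) → ∀ y ∈ ball x r, u y ≤ h y

end

/-! Off the support, `V` is smooth. Put `κ = n/ω_n`, `A = ∫ ρ(ζ)(ζ-x)|ζ-x|^{-n-2}` and `J = ∫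
ρ(ζ)|ζ-x|^{-n-2}`. Then `∇V = nκA` and `ΔV = 2nκJ`. Since `M' = 1 - M^{2/n}`, the chain rule for `F
= Φ(V)` writes `ΔF` as a nonnegative factor times `mJ - κ|A|²`, where `m = M(V)`. So when `V > 0`,
subharmonicity follows from the sharp estimate `κ|A|² ≤ mJ` (`IsDensity.gradient_ineq`) and the
maximum principle.

The estimate is a bathtub argument (`IsDensity.quadratic_ineq`). Given a unit vector `e` and `a >
0`, take the ball `D` with centre on the ray from `x` along `e` whose potential at `x` is that of
`ρ` and whose boundary is the zero set of `1 - 2a⟨e,ζ-x⟩ + β|ζ-x|²` for a suitable `β`. This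
quadratic is negative exactly inside `D`, so, weighted by `|ζ-x|^{-n-2}`, its integral against `ρ`
is at least its integral over `D`. The `β` terms are multiples of the equal potentials and cancel.
What remains is `J - 2a⟨e,A⟩ + (ω_n/n)ma² ≥ 0`; choose `e` along `A` and minimise in `a`.

All of this needs the potential of a ball in closed form (`potentialV_indicator_ball`). For `z`
outside the centred ball of radius `R`, the Poisson kernel `(|z|²-|y|²)/|y-z|^n` is harmonic in `y`
for `|y| < |z|`. The mean value property with radial weight `(|z|²-|y|²)⁻¹` replaces the integral of
`|y-z|^{-n}` by a radial one, and `μ = (t/|z|)^n` turns that into `∫₀ dμ/(1-μ^{2/n})`, the inverse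
of the profile. Hence `M(V) = (R/|x-c|)^n` for a ball, and `F` is, up to constants, the logarithmic
or Newtonian kernel: this is the harmonic case. -/

open Filter Topology InnerProductSpace Laplacian

/-! ### Second-order calculus and the weak maximum principle. -/

section Hessian

variable {E : Type*} [NormedAddCommGroup E] [InnerProductSpace ℝ E]

/-- `f` has derivative `f'` near `x`, and `f'` has derivative `B` at `x`. -/
structure HasHessianAt (f : E → ℝ) (f' : E → E →L[ℝ] ℝ) (B : E →L[ℝ] E →L[ℝ] ℝ) (x : E) :
    Prop where
  first : ∀ᶠ y in 𝓝 x, HasFDerivAt f (f' y) y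
  second : HasFDerivAt f' B x

variable (E) in
/-- The inner product as a continuous bilinear form. -/
noncomputable def innerBilin : E →L[ℝ] E →L[ℝ] ℝ := innerSL ℝ

theorem innerBilin_apply (v w : E) : innerBilin E v w = inner ℝ v w := rfl

/-- The trace of a bilinear form with respect to an orthonormal basis. -/
noncomputable def bilinTrace [FiniteDimensional ℝ E] (B : E →L[ℝ] E →L[ℝ] ℝ) : ℝ :=
  ∑ i, B (stdOrthonormalBasis ℝ E i) (stdOrthonormalBasis ℝ E i)

theorem HasHessianAt.laplacian [FiniteDimensional ℝ E] {f : E → ℝ} {f' : E → E →L[ℝ] ℝ}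
    {B : E →L[ℝ] E →L[ℝ] ℝ} {x : E}
    (h : HasHessianAt f f' B x) : Δ f x = bilinTrace B := by
  have h1 : fderiv ℝ f =ᶠ[𝓝 x] f' := h.first.mono fun y hy => hy.fderiv
  have h2 : fderiv ℝ (fderiv ℝ f) x = B := (h.second.congr_of_eventuallyEq h1).fderiv
  rw [laplacian_eq_iteratedFDeriv_stdOrthonormalBasis]
  simp [bilinTrace, iteratedFDeriv_two_apply, h2]

theorem ContDiffAt.hasHessianAt {f : E → ℝ} {x : E} (h : ContDiffAt ℝ 2 f x) :
    HasHessianAt f (fderiv ℝ f) (fderiv ℝ (fderiv ℝ f) x) x := by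
  refine ⟨?_, ?_⟩
  · filter_upwards [h.eventually (by simp)] with y hy
    exact (hy.differentiableAt (by norm_num)).hasFDerivAt
  · have : ContDiffAt ℝ 1 (fderiv ℝ f) x := h.fderiv_right (by norm_num)
    exact (this.differentiableAt (by norm_num)).hasFDerivAt

theorem HasHessianAt.congr {f g : E → ℝ} {f' : E → E →L[ℝ] ℝ} {B : E →L[ℝ] E →L[ℝ] ℝ} {x : E}
    (h : HasHessianAt f f' B x) (hfg : g =ᶠ[𝓝 x] f) : HasHessianAt g f' B x := by
  refine ⟨?_, h.second⟩
  filter_upwards [h.first, hfg.eventually_nhds] with y hy hy2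
  exact hy.congr_of_eventuallyEq hy2

theorem HasHessianAt.continuousAt {f : E → ℝ} {f' : E → E →L[ℝ] ℝ} {B : E →L[ℝ] E →L[ℝ] ℝ} {x : E}
    (h : HasHessianAt f f' B x) : ContinuousAt f x :=
  h.first.self_of_nhds.continuousAt

theorem HasHessianAt.add {f g : E → ℝ} {f' g' : E → E →L[ℝ] ℝ} {B C : E →L[ℝ] E →L[ℝ] ℝ} {x : E}
    (hf : HasHessianAt f f' B x) (hg : HasHessianAt g g' C x) :
    HasHessianAt (f + g) (f' + g') (B + C) x := by
  refine ⟨?_, hf.second.add hg.second⟩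
  filter_upwards [hf.first, hg.first] with y h1 h2 using h1.add h2

theorem HasHessianAt.sub {f g : E → ℝ} {f' g' : E → E →L[ℝ] ℝ} {B C : E →L[ℝ] E →L[ℝ] ℝ} {x : E}
    (hf : HasHessianAt f f' B x) (hg : HasHessianAt g g' C x) :
    HasHessianAt (f - g) (f' - g') (B - C) x := by
  refine ⟨?_, hf.second.sub hg.second⟩
  filter_upwards [hf.first, hg.first] with y h1 h2 using h1.sub h2

theorem HasHessianAt.const_smul {f : E → ℝ} {f' : E → E →L[ℝ] ℝ} {B : E →L[ℝ] E →L[ℝ] ℝ} {x : E}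
    (hf : HasHessianAt f f' B x) (a : ℝ) : HasHessianAt (a • f) (a • f') (a • B) x := by
  refine ⟨?_, hf.second.const_smul a⟩
  filter_upwards [hf.first] with y h1 using h1.const_smul a

theorem HasHessianAt.comp {f : E → ℝ} {f' : E → E →L[ℝ] ℝ} {B : E →L[ℝ] E →L[ℝ] ℝ} {x : E}
    (hf : HasHessianAt f f' B x) {φ φ' : ℝ → ℝ} {φ'' : ℝ}
    (h1 : ∀ᶠ t in 𝓝 (f x), HasDerivAt φ (φ' t) t) (h2 : HasDerivAt φ' φ'' (f x)) :
    HasHessianAt (fun y => φ (f y)) (fun y => φ' (f y) • f' y)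
      (φ' (f x) • B + (φ'' • f' x).smulRight (f' x)) x := by
  refine ⟨?_, ?_⟩
  · filter_upwards [hf.first, hf.continuousAt.eventually h1] with y hy hy2
    exact hy2.comp_hasFDerivAt y hy
  · exact (h2.comp_hasFDerivAt x hf.first.self_of_nhds).smul hf.second

theorem HasHessianAt.mul {f g : E → ℝ} {f' g' : E → E →L[ℝ] ℝ} {B C : E →L[ℝ] E →L[ℝ] ℝ} {x : E}
    (hf : HasHessianAt f f' B x) (hg : HasHessianAt g g' C x) :
    HasHessianAt (fun y => f y * g y) (fun y => f y • g' y + g y • f' y)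
      ((f x • C + (f' x).smulRight (g' x)) + (g x • B + (g' x).smulRight (f' x))) x := by
  refine ⟨?_, ?_⟩
  · filter_upwards [hf.first, hg.first] with y h1 h2 using h1.mul h2
  · exact (hf.first.self_of_nhds.smul hg.second).add (hg.first.self_of_nhds.smul hf.second)

theorem bilinTrace_add [FiniteDimensional ℝ E] (B C : E →L[ℝ] E →L[ℝ] ℝ) :
    bilinTrace (B + C) = bilinTrace B + bilinTrace C := by
  simp [bilinTrace, Finset.sum_add_distrib]

theorem bilinTrace_sub [FiniteDimensional ℝ E] (B C : E →L[ℝ] E →L[ℝ] ℝ) :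
    bilinTrace (B - C) = bilinTrace B - bilinTrace C := by
  simp [bilinTrace, Finset.sum_sub_distrib]

theorem bilinTrace_smul [FiniteDimensional ℝ E] (a : ℝ) (B : E →L[ℝ] E →L[ℝ] ℝ) :
    bilinTrace (a • B) = a * bilinTrace B := by
  simp [bilinTrace, Finset.mul_sum]

theorem bilinTrace_smulRight [FiniteDimensional ℝ E] (v w : E) :
    bilinTrace ((innerSL ℝ v).smulRight (innerSL ℝ w)) = inner ℝ v w := by
  simp only [bilinTrace, ContinuousLinearMap.smulRight_apply, innerSL_apply_apply,
    _root_.smul_apply, smul_eq_mul]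
  rw [← (stdOrthonormalBasis ℝ E).sum_inner_mul_inner v w]
  refine Finset.sum_congr rfl fun i _ => ?_
  rw [real_inner_comm w]

theorem bilinTrace_innerBilin [FiniteDimensional ℝ E] :
    bilinTrace (innerBilin E) = Module.finrank ℝ E := by
  simp [bilinTrace, innerBilin_apply]

theorem hasHessianAt_norm_sub_sq (c x : E) :
    HasHessianAt (fun y => ‖y - c‖ ^ 2) (fun y => (2 : ℝ) • innerSL ℝ (y - c))
      ((2 : ℝ) • innerBilin E) x := by
  refine ⟨Eventually.of_forall fun y => ?_, ?_⟩
  · have := ((hasFDerivAt_id y).sub_const c).norm_sq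
    refine this.congr_fderiv ?_
    ext v
    simp
  · exact (((innerBilin E).hasFDerivAt (x := x - c)).comp x
      ((hasFDerivAt_id x).sub_const c)).const_smul (2 : ℝ)

/-- Gradient and Hessian of a radial function `g (‖y - c‖²)`. -/
theorem hasHessianAt_radial {c x : E} {g g' : ℝ → ℝ} {g'' : ℝ}
    (h1 : ∀ᶠ t in 𝓝 (‖x - c‖ ^ 2), HasDerivAt g (g' t) t) (h2 : HasDerivAt g' g'' (‖x - c‖ ^ 2)) :
    HasHessianAt (fun y => g (‖y - c‖ ^ 2))
      (fun y => (2 * g' (‖y - c‖ ^ 2)) • innerSL ℝ (y - c))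
      ((2 * g' (‖x - c‖ ^ 2)) • innerBilin E +
        (4 * g'') • (innerSL ℝ (x - c)).smulRight (innerSL ℝ (x - c))) x := by
  have := (hasHessianAt_norm_sub_sq c x).comp h1 h2
  convert this using 1
  · ext y v
    simp; ring
  · ext v w
    simp [innerBilin_apply]; ring

theorem bilinTrace_radial [FiniteDimensional ℝ E] (a b : ℝ) (v : E) :
    bilinTrace (a • innerBilin E + b • (innerSL ℝ v).smulRight (innerSL ℝ v)) =
      a * Module.finrank ℝ E + b * ‖v‖ ^ 2 := by
  rw [bilinTrace_add, bilinTrace_smul, bilinTrace_smul, bilinTrace_smulRight, bilinTrace_innerBilin,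
    real_inner_self_eq_norm_sq]

/-- At a local maximum the Hessian is negative semidefinite. -/
theorem HasHessianAt.nonpos_of_isLocalMax {f : E → ℝ} {f' : E → E →L[ℝ] ℝ}
    {B : E →L[ℝ] E →L[ℝ] ℝ} {x : E} (h : HasHessianAt f f' B x) (hmax : IsLocalMax f x) (v : E) :
    B v v ≤ 0 := by
  by_contra! hpos
  set l : ℝ → E := fun t => x + t • v with hl
  have hl0 : l 0 = x := by simp [hl]
  have hld : ∀ t, HasDerivAt l v t := fun t => by
    simpa [hl] using ((hasDerivAt_id t).smul_const v).const_add x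
  have hlc : Tendsto l (𝓝 0) (𝓝 x) := by
    simpa [hl0] using (hld 0).continuousAt.tendsto
  have h1 : ∀ᶠ t in 𝓝 (0 : ℝ), HasDerivAt (f ∘ l) (f' (l t) v) t := by
    filter_upwards [hlc.eventually h.first] with t ht
    exact ht.comp_hasDerivAt t (hld t)
  have h2 : HasDerivAt (fun t => f' (l t) v) (B v v) 0 := by
    have h3 : HasFDerivAt f' B (l 0) := by rw [hl0]; exact h.second
    have := (h3.comp_hasDerivAt (0 : ℝ) (hld 0)).clm_apply (hasDerivAt_const (0 : ℝ) v)
    simpa using this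
  have hm : IsLocalMax (f ∘ l) 0 := by
    have := hlc.eventually hmax
    filter_upwards [this] with t ht
    simpa [hl0] using ht
  have hd1 : deriv (f ∘ l) =ᶠ[𝓝 0] fun t => f' (l t) v := h1.mono fun t ht => ht.deriv
  have hdd : deriv (deriv (f ∘ l)) 0 = B v v := (h2.congr_of_eventuallyEq hd1).deriv
  -- A positive second derivative makes the maximum also a local minimum, so the restriction to the
  -- line is locally constant and its second derivative vanishes.
  have hmin : IsLocalMin (f ∘ l) 0 :=
    isLocalMin_of_deriv_deriv_pos (by rw [hdd]; exact hpos) hm.deriv_eq_zero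
      h1.self_of_nhds.continuousAt
  have hconst : (f ∘ l) =ᶠ[𝓝 0] fun _ => (f ∘ l) 0 := by
    filter_upwards [hm, hmin] with t a b using le_antisymm a b
  have h0 : deriv (f ∘ l) =ᶠ[𝓝 0] fun _ => 0 := by
    filter_upwards [hconst.eventually_nhds] with t ht
    rw [EventuallyEq.deriv_eq ht, deriv_const]
  rw [h0.deriv_eq, deriv_const] at hdd
  linarith

/-- The weak maximum principle on a ball, for functions with nonnegative Laplacian. -/
theorem nonpos_of_hessian_trace_nonneg [FiniteDimensional ℝ E] [Nontrivial E] {w : E → ℝ} {x : E} {r : ℝ} (hr : 0 < r)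
    (hc : ContinuousOn w (closedBall x r))
    (hw : ∀ y ∈ ball x r, ∃ w' B, HasHessianAt w w' B y ∧ 0 ≤ bilinTrace B)
    (hs : ∀ y ∈ sphere x r, w y ≤ 0) : ∀ y ∈ ball x r, w y ≤ 0 := by
  have key : ∀ ε > 0, ∀ y ∈ ball x r, w y ≤ ε * r ^ 2 := by
    intro ε hε y hy
    -- Adding `ε‖y - x‖²` makes the trace strictly positive, which excludes an interior maximum; on
    -- the sphere the added term is `ε r²`.
    obtain ⟨z, hz, hzmax⟩ := (isCompact_closedBall x r).exists_isMaxOn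
      ⟨x, mem_closedBall_self hr.le⟩
      (f := w + ε • fun y => ‖y - x‖ ^ 2) (hc.add (by fun_prop))
    have hyz := hzmax (ball_subset_closedBall hy)
    simp only [mem_ofPred_eq, Pi.add_apply, Pi.smul_apply, smul_eq_mul] at hyz
    have hynn : 0 ≤ ε * ‖y - x‖ ^ 2 := by positivity
    rcases (mem_closedBall.1 hz).lt_or_eq with hlt | heq
    · exfalso
      obtain ⟨w', B, hB, htr⟩ := hw z hlt
      have hH := hB.add ((hasHessianAt_norm_sub_sq x z).const_smul ε)
      have hloc : IsLocalMax (w + ε • fun y => ‖y - x‖ ^ 2) z :=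
        hzmax.isLocalMax (mem_of_superset (isOpen_ball.mem_nhds hlt) ball_subset_closedBall)
      have hle : bilinTrace (B + ε • (2 : ℝ) • innerBilin E) ≤ 0 :=
        Finset.sum_nonpos fun i _ => hH.nonpos_of_isLocalMax hloc _
      rw [bilinTrace_add, bilinTrace_smul, bilinTrace_smul, bilinTrace_innerBilin] at hle
      have : (0 : ℝ) < Module.finrank ℝ E := by exact_mod_cast Module.finrank_pos
      have : 0 < ε * (2 * Module.finrank ℝ E) := by positivity
      linarith
    · have h1 := hs z heq
      rw [← dist_eq_norm z x, heq] at hyz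
      linarith
  intro y hy
  refine le_of_forall_pos_le_add fun δ hδ => ?_
  have := key (δ / r ^ 2) (by positivity) y hy
  rwa [div_mul_cancel₀ _ (by positivity), ← zero_add δ] at this

end Hessian

/-! ### The profile equation, solved by separation of variables. -/

section Profile

/-- The inverse of the profile: the time at which the solution reaches the value `m`. -/
noncomputable def profileTime (n : ℕ) (m : ℝ) : ℝ :=
  ∫ μ in (0 : ℝ)..m, (1 - |μ| ^ ((2 : ℝ) / n))⁻¹

variable {n : ℕ}

theorem one_sub_abs_rpow_pos (hn : 0 < n) {m : ℝ} (hm : |m| < 1) :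
    0 < 1 - |m| ^ ((2 : ℝ) / n) := by
  have : |m| ^ ((2 : ℝ) / n) < 1 := Real.rpow_lt_one (abs_nonneg m) hm (by positivity)
  linarith

theorem continuousAt_profileTime_integrand (hn : 0 < n) {m : ℝ} (hm : |m| < 1) :
    ContinuousAt (fun μ : ℝ => (1 - |μ| ^ ((2 : ℝ) / n))⁻¹) m := by
  have h1 : Continuous fun μ : ℝ => |μ| ^ ((2 : ℝ) / n) :=
    continuous_abs.rpow_const fun _ => Or.inr (by positivity)
  exact (continuous_const.sub h1).continuousAt.inv₀ (one_sub_abs_rpow_pos hn hm).ne'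

theorem hasDerivAt_profileTime (hn : 0 < n) {m : ℝ} (hm : |m| < 1) :
    HasDerivAt (profileTime n) (1 - |m| ^ ((2 : ℝ) / n))⁻¹ m := by
  have hsub : ∀ μ ∈ uIcc 0 m, |μ| < 1 := by
    intro μ hμ
    refine lt_of_le_of_lt ?_ hm
    simpa using abs_sub_left_of_mem_uIcc hμ
  refine intervalIntegral.integral_hasDerivAt_right ?_ ?_
    (continuousAt_profileTime_integrand hn hm)
  · exact ContinuousOn.intervalIntegrable fun μ hμ =>
      (continuousAt_profileTime_integrand hn (hsub μ hμ)).continuousWithinAt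
  · have ho : IsOpen {μ : ℝ | |μ| < 1} := isOpen_lt continuous_abs continuous_const
    exact ContinuousOn.stronglyMeasurableAtFilter ho
      (fun μ hμ => (continuousAt_profileTime_integrand hn hμ).continuousWithinAt) m hm

theorem profileTime_zero : profileTime n 0 = 0 := by simp [profileTime]

/-- The absolute value makes the integrand even and continuous across `0`. Oddness then gives an
inverse on the whole line, so the derivative at time `0` needs no one-sided treatment. -/
theorem profileTime_neg (m : ℝ) : profileTime n (-m) = -profileTime n m := by
  have := intervalIntegral.integral_comp_neg (a := 0) (b := m)
    (fun μ : ℝ => (1 - |μ| ^ ((2 : ℝ) / n))⁻¹)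
  simp only [abs_neg, neg_zero] at this
  rw [profileTime, profileTime, this, intervalIntegral.integral_symm]

theorem sub_le_profileTime_sub (hn : 0 < n) {a b : ℝ} (ha : -1 < a) (hab : a ≤ b) (hb : b < 1) :
    b - a ≤ profileTime n b - profileTime n a := by
  have habs : ∀ x ∈ Icc a b, |x| < 1 := fun x hx =>
    abs_lt.2 ⟨ha.trans_le hx.1, hx.2.trans_lt hb⟩
  have := (convex_Icc a b).mul_sub_le_image_sub_of_le_deriv (f := profileTime n) (C := 1)
    (fun x hx => (hasDerivAt_profileTime hn (habs x hx)).continuousAt.continuousWithinAt)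
    (fun x hx => (hasDerivAt_profileTime hn
      (habs x (interior_subset hx))).differentiableAt.differentiableWithinAt)
    (fun x hx => by
      rw [(hasDerivAt_profileTime hn (habs x (interior_subset hx))).deriv]
      refine (one_le_inv₀ (one_sub_abs_rpow_pos hn (habs x (interior_subset hx)))).2 ?_
      have : 0 ≤ |x| ^ ((2 : ℝ) / n) := by positivity
      linarith)
    a (left_mem_Icc.2 hab) b (right_mem_Icc.2 hab) hab
  linarith

/-- The integrand is at least `1`. This yields both injectivity and the 1-Lipschitz bound for the
inverse. -/
theorem abs_sub_le_profileTime (hn : 0 < n) {a b : ℝ} (ha : |a| < 1) (hb : |b| < 1) :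
    |a - b| ≤ |profileTime n a - profileTime n b| := by
  rw [abs_lt] at ha hb
  rcases le_total a b with h | h
  · rw [abs_sub_comm, abs_sub_comm (profileTime n a), abs_of_nonneg (sub_nonneg.2 h)]
    exact (sub_le_profileTime_sub hn ha.1 h hb.2).trans (le_abs_self _)
  · rw [abs_of_nonneg (sub_nonneg.2 h)]
    exact (sub_le_profileTime_sub hn hb.1 h ha.2).trans (le_abs_self _)

/-- As `2/n ≤ 1`, one has `μ ≤ μ^{2/n}` on `[0,1]`, so the integrand dominates `1/(1-μ)`. Thus the
value `1` is not reached in finite time, which is why solutions are global. -/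
theorem neg_log_one_sub_le_profileTime (hn : 2 ≤ n) {m : ℝ} (h0 : 0 ≤ m) (h1 : m < 1) :
    -Real.log (1 - m) ≤ profileTime n m := by
  have hn0 : 0 < n := by omega
  have habs : ∀ x ∈ Icc 0 m, |x| < 1 := fun x hx =>
    abs_lt.2 ⟨by linarith [hx.1], hx.2.trans_lt h1⟩
  have hd : ∀ x ∈ Icc 0 m, HasDerivAt (fun x => profileTime n x + Real.log (1 - x))
      ((1 - |x| ^ ((2 : ℝ) / n))⁻¹ + (-1) / (1 - x)) x := by
    intro x hx
    have : 1 - x ≠ 0 := by linarith [hx.2]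
    exact (hasDerivAt_profileTime hn0 (habs x hx)).add
      (((hasDerivAt_id x).const_sub 1).log this)
  have hmono : MonotoneOn (fun x => profileTime n x + Real.log (1 - x)) (Icc 0 m) := by
    refine monotoneOn_of_deriv_nonneg (convex_Icc 0 m)
      (fun x hx => (hd x hx).continuousAt.continuousWithinAt)
      (fun x hx => (hd x (interior_subset hx)).differentiableAt.differentiableWithinAt) ?_
    intro x hx
    have hx := interior_subset hx
    rw [(hd x hx).deriv, abs_of_nonneg hx.1, neg_div, one_div]
    have hx1 : x < 1 := hx.2.trans_lt h1
    have hle : x ≤ x ^ ((2 : ℝ) / n) := by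
      refine Real.self_le_rpow_of_le_one hx.1 hx1.le ?_
      rw [div_le_one (by positivity)]
      exact_mod_cast hn
    have hpos := one_sub_abs_rpow_pos hn0 (habs x hx)
    rw [abs_of_nonneg hx.1] at hpos
    have := inv_anti₀ hpos (by linarith : 1 - x ^ ((2 : ℝ) / n) ≤ 1 - x)
    linarith
  have := hmono (left_mem_Icc.2 h0) (right_mem_Icc.2 h0) h0
  simp only [profileTime_zero, sub_zero, Real.log_one, add_zero] at this
  linarith

theorem exists_profileTime_eq_of_nonneg (hn : 2 ≤ n) {t : ℝ} (ht : 0 ≤ t) :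
    ∃ m, |m| < 1 ∧ profileTime n m = t ∧ 0 ≤ m := by
  have hn0 : 0 < n := by omega
  -- The endpoint `1 - exp(-t)` is where the logarithmic lower bound equals `t`.
  have hb0 : 0 ≤ 1 - Real.exp (-t) := by
    have : Real.exp (-t) ≤ 1 := Real.exp_le_one_iff.2 (by linarith)
    linarith
  have hb1 : 1 - Real.exp (-t) < 1 := by linarith [Real.exp_pos (-t)]
  have hle : t ≤ profileTime n (1 - Real.exp (-t)) := by
    simpa using neg_log_one_sub_le_profileTime hn hb0 hb1
  have hc : ContinuousOn (profileTime n) (Icc 0 (1 - Real.exp (-t))) := fun x hx =>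
    (hasDerivAt_profileTime hn0 (abs_lt.2 ⟨by linarith [hx.1],
      hx.2.trans_lt hb1⟩)).continuousAt.continuousWithinAt
  obtain ⟨m, hm, hmt⟩ := intermediate_value_Icc hb0 hc ⟨by rw [profileTime_zero]; exact ht, hle⟩
  exact ⟨m, abs_lt.2 ⟨by linarith [hm.1], hm.2.trans_lt hb1⟩, hmt, hm.1⟩

theorem exists_profileTime_eq (hn : 2 ≤ n) (t : ℝ) : ∃ m, |m| < 1 ∧ profileTime n m = t := by
  rcases le_total 0 t with ht | ht
  · obtain ⟨m, h1, h2, -⟩ := exists_profileTime_eq_of_nonneg hn ht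
    exact ⟨m, h1, h2⟩
  · obtain ⟨m, h1, h2, -⟩ := exists_profileTime_eq_of_nonneg hn (neg_nonneg.2 ht)
    exact ⟨-m, by rwa [abs_neg], by rw [profileTime_neg, h2, neg_neg]⟩

theorem exists_profile (hn : 2 ≤ n) :
    ∃ M : ℝ → ℝ, IsProfile n M ∧ (∀ t, |M t| < 1) ∧ (∀ t, profileTime n (M t) = t) ∧
      ∀ t, 0 ≤ t → 0 ≤ M t := by
  have hn0 : 0 < n := by omega
  choose M hM1 hM2 using exists_profileTime_eq hn
  have hinj : ∀ a b, |a| < 1 → |b| < 1 → profileTime n a = profileTime n b → a = b := by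
    intro a b ha hb h
    have := abs_sub_le_profileTime hn0 ha hb
    rw [h, sub_self, abs_zero] at this
    exact sub_eq_zero.1 (abs_nonpos_iff.1 this)
  have hnn : ∀ t, 0 ≤ t → 0 ≤ M t := by
    intro t ht
    obtain ⟨m, h1, h2, h3⟩ := exists_profileTime_eq_of_nonneg hn ht
    rwa [hinj (M t) m (hM1 t) h1 ((hM2 t).trans h2.symm)]
  have hlip : LipschitzWith 1 M := LipschitzWith.of_dist_le_mul fun a b => by
    have := abs_sub_le_profileTime hn0 (hM1 a) (hM1 b)
    rw [hM2, hM2] at this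
    simpa [Real.dist_eq] using this
  refine ⟨M, ⟨?_, fun t ht => ?_⟩, hM1, hM2, hnn⟩
  · exact hinj _ _ (hM1 0) (by simp) (by rw [hM2, profileTime_zero])
  · have hpos := one_sub_abs_rpow_pos hn0 (hM1 t)
    have := HasDerivAt.of_local_left_inverse hlip.continuous.continuousAt
      (hasDerivAt_profileTime hn0 (hM1 t)) (inv_ne_zero hpos.ne') (Eventually.of_forall hM2)
    rw [inv_inv, abs_of_nonneg (hnn t ht)] at this
    exact this.hasDerivWithinAt

namespace IsProfile

variable {M : ℝ → ℝ}

theorem continuousOn (hM : IsProfile n M) : ContinuousOn M (Ici 0) := fun t ht =>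
  (hM.2 t ht).continuousWithinAt

theorem hasDerivAt (hM : IsProfile n M) {t : ℝ} (ht : 0 < t) :
    HasDerivAt M (1 - M t ^ ((2 : ℝ) / n)) t :=
  (hM.2 t ht.le).hasDerivAt (Ici_mem_nhds ht)

/-- At any zero of `M` the derivative is `1`, so `M` cannot cross downwards. This must precede any
use of monotonicity of the real power, which requires a nonnegative base. -/
theorem nonneg (hn : 0 < n) (hM : IsProfile n M) {t : ℝ} (ht : 0 ≤ t) : 0 ≤ M t := by
  have := image_le_of_deriv_right_lt_deriv_boundary (f := fun x => -M x)
    (f' := fun x => -(1 - M x ^ ((2 : ℝ) / n))) (a := 0) (b := t) (B := fun _ => 0)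
    (B' := fun _ => 0) ((hM.continuousOn.mono Icc_subset_Ici_self).neg)
    (fun x hx => ((hM.2 x hx.1).mono (Ici_subset_Ici.2 hx.1)).neg) (by simp [hM.1])
    (fun x => hasDerivAt_const x 0) (fun x hx h => by
      have h : M x = 0 := by linarith
      rw [h, Real.zero_rpow (by positivity)]
      norm_num) (right_mem_Icc.2 ht)
  simpa using this

/-- Solutions are unique, because the right-hand side is decreasing in the unknown. -/
theorem unique (hn : 0 < n) {N : ℝ → ℝ} (hM : IsProfile n M) (hN : IsProfile n N) {t : ℝ}
    (ht : 0 ≤ t) : M t = N t := by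
  have hanti : AntitoneOn (fun x => (M x - N x) ^ 2) (Ici 0) := by
    refine antitoneOn_of_deriv_nonpos (convex_Ici 0) ((hM.continuousOn.sub hN.continuousOn).pow 2)
      (fun x hx => ?_) fun x hx => ?_
    · rw [interior_Ici] at hx
      exact (((hM.hasDerivAt hx).sub (hN.hasDerivAt hx)).pow
        2).differentiableAt.differentiableWithinAt
    · rw [interior_Ici] at hx
      have hd := ((hM.hasDerivAt hx).sub (hN.hasDerivAt hx)).pow 2
      have hd' : deriv (fun x => (M x - N x) ^ 2) x = _ := hd.deriv
      rw [hd']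
      have hm := hM.nonneg hn (le_of_lt hx)
      have hk := hN.nonneg hn (le_of_lt hx)
      have h2 : (0 : ℝ) ≤ 2 / n := by positivity
      simp only [Nat.cast_ofNat, Pi.sub_apply, Nat.add_one_sub_one, pow_one]
      rcases le_total (M x) (N x) with h | h
      · have := Real.rpow_le_rpow hm h h2
        nlinarith
      · have := Real.rpow_le_rpow hk h h2
        nlinarith
  have := hanti self_mem_Ici (mem_Ici.2 ht) ht
  simp only [hM.1, hN.1, sub_self] at this
  have h0 : (M t - N t) ^ 2 = 0 := le_antisymm (by simpa using this) (sq_nonneg _)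
  exact sub_eq_zero.1 (pow_eq_zero_iff (by norm_num) |>.1 h0)

theorem profileTime_eq (hn : 2 ≤ n) (hM : IsProfile n M) {t : ℝ} (ht : 0 ≤ t) :
    profileTime n (M t) = t := by
  obtain ⟨N, hN, -, h2, -⟩ := exists_profile hn
  rw [hM.unique (by omega) hN ht, h2]

theorem lt_one (hn : 2 ≤ n) (hM : IsProfile n M) {t : ℝ} (ht : 0 ≤ t) : M t < 1 := by
  obtain ⟨N, hN, h1, -, -⟩ := exists_profile hn
  rw [hM.unique (by omega) hN ht]
  exact (abs_lt.1 (h1 t)).2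

theorem pos (hn : 2 ≤ n) (hM : IsProfile n M) {t : ℝ} (ht : 0 < t) : 0 < M t := by
  refine (hM.nonneg (by omega) ht.le).lt_of_ne fun h => ?_
  have := hM.profileTime_eq hn ht.le
  rw [← h, profileTime_zero] at this
  exact ht.ne this

theorem apply_profileTime (hn : 2 ≤ n) (hM : IsProfile n M) {m : ℝ} (h0 : 0 ≤ m) (h1 : m < 1) :
    M (profileTime n m) = m := by
  have hn0 : 0 < n := by omega
  have ht : 0 ≤ profileTime n m := by
    have := sub_le_profileTime_sub hn0 (by norm_num) h0 h1
    rw [profileTime_zero] at this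
    linarith
  have hm : |m| < 1 := abs_lt.2 ⟨by linarith, h1⟩
  have hM' : |M (profileTime n m)| < 1 :=
    abs_lt.2 ⟨by linarith [hM.nonneg hn0 ht], hM.lt_one hn ht⟩
  have := abs_sub_le_profileTime hn0 hM' hm
  rw [hM.profileTime_eq hn ht, sub_self, abs_zero] at this
  exact sub_eq_zero.1 (abs_nonpos_iff.1 this)

end IsProfile

end Profile

/-! ### The mean value property against radial weights, without surface integrals. -/

section MeanValue

variable {E : Type*} [NormedAddCommGroup E] [InnerProductSpace ℝ E] [FiniteDimensional ℝ E]
  [MeasurableSpace E] [BorelSpace E] {μ : Measure E}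

theorem integrable_of_continuousOn_closedBall [IsFiniteMeasureOnCompacts μ] {f : E → ℝ} {s : ℝ}
    (hf : ContinuousOn f (closedBall 0 s)) (h0 : ∀ y, s < ‖y‖ → f y = 0) : Integrable f μ := by
  refine (integrableOn_iff_integrable_of_support_subset (s := closedBall 0 s) fun y hy => ?_).1
    (hf.integrableOn_compact (isCompact_closedBall 0 s))
  by_contra hys
  exact hy (h0 y (by simpa using hys))

/-- The Gauss theorem against radial weights: the radial derivative of a harmonic function has
vanishing integral against every continuous radial weight supported in the ball. -/
theorem integral_radial_mul_fderiv_apply_self [μ.IsAddHaarMeasure] {u : E → ℝ} {d s : ℝ}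
    (hu : HarmonicOnNhd u (ball 0 d)) (hs : 0 ≤ s) (hsd : s < d) {φ : ℝ → ℝ} (hφ : Continuous φ)
    (hφ0 : ∀ q, s ^ 2 ≤ q → φ q = 0) : ∫ y, φ (‖y‖ ^ 2) * fderiv ℝ u y y ∂μ = 0 := by
  -- `Θ` is the antiderivative of `φ/2` vanishing beyond `s²`, so `ψ = Θ(‖y‖²)` is supported in the
  -- ball and has gradient `φ(‖y‖²) y`. Integrating `ψ Δu = 0` by parts gives the claim.
  set Θ : ℝ → ℝ := fun q => (∫ p in (s ^ 2)..q, φ p) / 2 with hΘ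
  have hΘd : ∀ q, HasDerivAt Θ (φ q / 2) q := fun q =>
    (hφ.integral_hasStrictDerivAt (s ^ 2) q).hasDerivAt.div_const 2
  have hΘ0 : ∀ q, s ^ 2 ≤ q → Θ q = 0 := by
    intro q hq
    have : ∫ p in (s ^ 2)..q, φ p = ∫ p in (s ^ 2)..q, (0 : ℝ) :=
      intervalIntegral.integral_congr fun p hp => hφ0 p (by rw [uIcc_of_le hq] at hp; exact hp.1)
    simp [hΘ, this]
  set ψ : E → ℝ := fun y => Θ (‖y‖ ^ 2) with hψ
  have hψd : ∀ y, HasFDerivAt ψ (φ (‖y‖ ^ 2) • innerSL ℝ y) y := by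
    intro y
    have := (hΘd (‖y‖ ^ 2)).comp_hasFDerivAt y (hasFDerivAt_id y).norm_sq
    refine this.congr_fderiv ?_
    ext v
    simp
    ring
  have hψc : Continuous ψ := continuous_iff_continuousAt.2 fun y => (hψd y).continuousAt
  have hψ0 : ∀ y, s < ‖y‖ → ψ y = 0 := fun y hy => hΘ0 _ (by gcongr)
  have hφn0 : ∀ y : E, s < ‖y‖ → φ (‖y‖ ^ 2) = 0 := fun y hy => hφ0 _ (by gcongr)
  have hts : tsupport ψ ⊆ closedBall 0 s := by
    refine closure_minimal (fun y hy => ?_) isClosed_closedBall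
    by_contra hys
    exact hy (hψ0 y (by simpa using hys))
  have hsub : closedBall (0 : E) s ⊆ ball 0 d := closedBall_subset_ball hsd
  have hcd1 : ∀ y ∈ ball (0 : E) d, ContDiffAt ℝ 1 (fderiv ℝ u) y := fun y hy =>
    (hu y hy).1.fderiv_right (by norm_num)
  have hc1 : ContinuousOn (fderiv ℝ u) (closedBall 0 s) := fun y hy =>
    (hcd1 y (hsub hy)).continuousAt.continuousWithinAt
  have hc2 : ContinuousOn (fderiv ℝ (fderiv ℝ u)) (closedBall 0 s) := fun y hy =>
    ((hcd1 y (hsub hy)).fderiv_right (m := 0) (by norm_num)).continuousAt.continuousWithinAt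
  have hparts : ∀ b : E, Integrable (fun y => ψ y * fderiv ℝ (fderiv ℝ u) y b b) μ ∧
      Integrable (fun y => φ (‖y‖ ^ 2) * (inner ℝ y b * fderiv ℝ u y b)) μ ∧
      ∫ y, ψ y * fderiv ℝ (fderiv ℝ u) y b b ∂μ =
        -∫ y, φ (‖y‖ ^ 2) * (inner ℝ y b * fderiv ℝ u y b) ∂μ := by
    intro b
    have hi1 : Integrable (fun y => φ (‖y‖ ^ 2) * (inner ℝ y b * fderiv ℝ u y b)) μ := by
      refine integrable_of_continuousOn_closedBall (s := s) ?_ fun y hy => by simp [hφn0 y hy]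
      have : Continuous fun y : E => φ (‖y‖ ^ 2) := by fun_prop
      have h2 : Continuous fun y : E => (inner ℝ y b : ℝ) := by fun_prop
      exact this.continuousOn.mul (h2.continuousOn.mul (hc1.clm_apply continuousOn_const))
    have hi2 : Integrable (fun y => ψ y * fderiv ℝ (fderiv ℝ u) y b b) μ := by
      refine integrable_of_continuousOn_closedBall (s := s) ?_ fun y hy => by simp [hψ0 y hy]
      exact hψc.continuousOn.mul ((hc2.clm_apply continuousOn_const).clm_apply continuousOn_const)
    have hi3 : Integrable (fun y => ψ y * fderiv ℝ u y b) μ := by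
      refine integrable_of_continuousOn_closedBall (s := s) ?_ fun y hy => by simp [hψ0 y hy]
      exact hψc.continuousOn.mul (hc1.clm_apply continuousOn_const)
    refine ⟨hi2, hi1, ?_⟩
    have := integral_bilinear_hasFDerivAt_right_eq_neg_left_of_integrable (μ := μ)
      (f := ψ) (f' := fun y => φ (‖y‖ ^ 2) • innerSL ℝ y) (g := fun y => fderiv ℝ u y b)
      (g' := fun y => (fderiv ℝ (fderiv ℝ u) y).flip b) (v := b)
      (B := ContinuousLinearMap.mul ℝ ℝ) (by simpa [mul_assoc] using hi1) (by simpa using hi2)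
      (by simpa using hi3) (fun y _ => hψd y) (fun y hy => by
        have h1 := ((hcd1 y (hsub (hts hy))).differentiableAt (by norm_num)).hasFDerivAt
        have h2 := h1.clm_apply (hasFDerivAt_const b y)
        refine h2.congr_fderiv ?_
        ext v
        simp)
    simpa [mul_assoc] using this
  have hsum : ∑ i, ∫ y, ψ y * fderiv ℝ (fderiv ℝ u) y (stdOrthonormalBasis ℝ E i)
      (stdOrthonormalBasis ℝ E i) ∂μ = 0 := by
    rw [← integral_finsetSum _ fun i _ => (hparts _).1]
    refine integral_eq_zero_of_ae (Eventually.of_forall fun y => ?_)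
    simp only [Pi.zero_apply]
    rcases lt_or_ge s ‖y‖ with hy | hy
    · simp [hψ0 y hy]
    · have hyb : y ∈ ball (0 : E) d := hsub (by simpa using hy)
      have h1 := (hu y hyb).1.hasHessianAt.laplacian
      rw [(hu y hyb).2.self_of_nhds] at h1
      rw [← Finset.mul_sum]
      change ψ y * bilinTrace (fderiv ℝ (fderiv ℝ u) y) = 0
      rw [← h1]
      simp
  have hfin : ∫ y, φ (‖y‖ ^ 2) * fderiv ℝ u y y ∂μ =
      ∑ i, ∫ y, φ (‖y‖ ^ 2) * (inner ℝ y (stdOrthonormalBasis ℝ E i) *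
        fderiv ℝ u y (stdOrthonormalBasis ℝ E i)) ∂μ := by
    rw [← integral_finsetSum _ fun i _ => (hparts _).2.1]
    refine integral_congr_ae (Eventually.of_forall fun y => ?_)
    simp only
    rw [← Finset.mul_sum]
    congr 1
    generalize fderiv ℝ u y = L
    conv_lhs => rw [← (stdOrthonormalBasis ℝ E).sum_repr' y]
    simp only [map_sum, map_smul, smul_eq_mul]
    refine Finset.sum_congr rfl fun i _ => ?_
    rw [real_inner_comm]
  rw [hfin, ← neg_eq_zero, ← Finset.sum_neg_distrib, ← hsum]
  exact Finset.sum_congr rfl fun i _ => (hparts _).2.2.symm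

/-- The mean value property of harmonic functions against continuous radial weights. -/
theorem integral_radial_mul_sub_eq_zero [μ.IsAddHaarMeasure] {u : E → ℝ} {d s : ℝ}
    (hu : HarmonicOnNhd u (ball 0 d)) (hs : 0 ≤ s) (hsd : s < d) {φ : ℝ → ℝ} (hφ : Continuous φ)
    (hφ0 : ∀ q, s ^ 2 ≤ q → φ q = 0) : ∫ y, φ (‖y‖ ^ 2) * (u y - u 0) ∂μ = 0 := by
  have hφn0 : ∀ y : E, s < ‖y‖ → φ (‖y‖ ^ 2) = 0 := fun y hy => hφ0 _ (by gcongr)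
  have hmem : ∀ t ∈ Icc (0 : ℝ) 1, ∀ y ∈ closedBall (0 : E) s, t • y ∈ ball (0 : E) d := by
    intro t ht y hy
    rw [mem_closedBall_zero_iff] at hy
    rw [mem_ball_zero_iff, norm_smul, Real.norm_of_nonneg ht.1]
    nlinarith [ht.2, norm_nonneg y]
  have hcd1 : ∀ y ∈ ball (0 : E) d, ContinuousAt (fderiv ℝ u) y := fun y hy =>
    ((hu y hy).1.fderiv_right (m := 1) (by norm_num)).continuousAt
  -- Write `u y - u 0` as the integral of the derivative along the segment, then swap integrals:
  -- each time slice is, after rescaling, a radial derivative integral.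
  have hftc : ∀ y ∈ closedBall (0 : E) s,
      ∫ t in Icc (0 : ℝ) 1, φ (‖y‖ ^ 2) * fderiv ℝ u (t • y) y = φ (‖y‖ ^ 2) * (u y - u 0) := by
    intro y hy
    rw [integral_Icc_eq_integral_Ioc, ← intervalIntegral.integral_of_le zero_le_one,
      intervalIntegral.integral_const_mul]
    congr 1
    have hd : ∀ t ∈ uIcc (0 : ℝ) 1, HasDerivAt (fun t : ℝ => u (t • y)) (fderiv ℝ u (t • y) y) t := by
      intro t ht
      rw [uIcc_of_le zero_le_one] at ht
      have h1 := ((hu _ (hmem t ht y hy)).1.differentiableAt (by norm_num)).hasFDerivAt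
      have h2 : HasDerivAt (fun t : ℝ => t • y) y t := by
        simpa using (hasDerivAt_id t).smul_const y
      exact h1.comp_hasDerivAt t h2
    rw [intervalIntegral.integral_eq_sub_of_hasDerivAt hd]
    · simp
    · refine ContinuousOn.intervalIntegrable fun t ht => ?_
      rw [uIcc_of_le zero_le_one] at ht
      have h1 : ContinuousAt (fun t : ℝ => fderiv ℝ u (t • y)) t :=
        ContinuousAt.comp (f := fun t : ℝ => t • y) (hcd1 _ (hmem t ht y hy)) (by fun_prop)
      exact (h1.clm_apply continuousAt_const).continuousWithinAt
  have hset : ∀ f : E → ℝ, (∀ y, s < ‖y‖ → f y = 0) →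
      ∫ y in closedBall 0 s, f y ∂μ = ∫ y, f y ∂μ := by
    intro f hf
    refine setIntegral_eq_integral_of_forall_compl_eq_zero fun y hy => hf y ?_
    simpa using hy
  rw [← hset _ fun y hy => by simp [hφn0 y hy],
    setIntegral_congr_fun measurableSet_closedBall fun y hy => (hftc y hy).symm,
    integral_integral_swap]
  · refine integral_eq_zero_of_ae ?_
    rw [Filter.EventuallyEq, ae_restrict_iff' measurableSet_Icc]
    have hne : ∀ᵐ t : ℝ, t ≠ 0 := by simp [ae_iff, measure_singleton]
    filter_upwards [hne] with t ht0 ht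
    have htpos : 0 < t := lt_of_le_of_ne ht.1 (Ne.symm ht0)
    rw [hset _ fun y hy => by simp [hφn0 y hy]]
    -- The substitution `y ↦ t y` turns the weight into `φ(q/t²)`, supported in radius `t s`.
    have key := integral_radial_mul_fderiv_apply_self (μ := μ) hu (s := t * s) (by positivity)
      (by nlinarith [ht.2]) (φ := fun q => φ (q / t ^ 2)) (by fun_prop) (fun q hq => hφ0 _ (by
        rw [le_div_iff₀ (by positivity)]
        nlinarith))
    have hscale := Measure.integral_comp_smul μ
      (fun y => φ (‖y‖ ^ 2 / t ^ 2) * fderiv ℝ u y y) t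
    rw [key, smul_zero] at hscale
    have heq : ∀ y : E, φ (‖t • y‖ ^ 2 / t ^ 2) * fderiv ℝ u (t • y) (t • y) =
        t * (φ (‖y‖ ^ 2) * fderiv ℝ u (t • y) y) := by
      intro y
      rw [norm_smul, mul_pow, Real.norm_eq_abs, sq_abs, mul_div_cancel_left₀ _ (by positivity),
        map_smul, smul_eq_mul]
      ring
    simp only [heq, integral_const_mul] at hscale
    simpa [ht0] using hscale
  · rw [Measure.prod_restrict]
    have hc : ContinuousOn (Function.uncurry fun (y : E) (t : ℝ) =>
        φ (‖y‖ ^ 2) * fderiv ℝ u (t • y) y) (closedBall 0 s ×ˢ Icc 0 1) := by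
      rintro ⟨y, t⟩ ⟨hy, ht⟩
      have h1 : ContinuousAt (fun p : E × ℝ => fderiv ℝ u (p.2 • p.1)) (y, t) :=
        ContinuousAt.comp (f := fun p : E × ℝ => p.2 • p.1) (hcd1 _ (hmem t ht y hy))
          (by fun_prop)
      have h2 : ContinuousAt (fun p : E × ℝ => φ (‖p.1‖ ^ 2)) (y, t) := by fun_prop
      exact (h2.mul (h1.clm_apply continuousAt_fst)).continuousWithinAt
    exact hc.integrableOn_compact ((isCompact_closedBall 0 s).prod isCompact_Icc)

end MeanValue

/-! ### Powers of the distance and the Poisson kernel. -/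

section Kernel

variable {E : Type*} [NormedAddCommGroup E] [InnerProductSpace ℝ E]

theorem hasHessianAt_norm_sub_sq_rpow {c x : E} (hx : x ≠ c) (p : ℝ) :
    HasHessianAt (fun y => (‖y - c‖ ^ 2) ^ p)
      (fun y => (2 * (p * (‖y - c‖ ^ 2) ^ (p - 1))) • innerSL ℝ (y - c))
      ((2 * (p * (‖x - c‖ ^ 2) ^ (p - 1))) • innerBilin E +
        (4 * (p * ((p - 1) * (‖x - c‖ ^ 2) ^ (p - 1 - 1)))) •
          (innerSL ℝ (x - c)).smulRight (innerSL ℝ (x - c))) x := by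
  have hq : ‖x - c‖ ^ 2 ≠ 0 := by
    have := norm_pos_iff.2 (sub_ne_zero.2 hx)
    positivity
  refine hasHessianAt_radial (g := fun q => q ^ p) (g' := fun q => p * q ^ (p - 1)) ?_ ?_
  · filter_upwards [isOpen_ne.mem_nhds hq] with t ht
    exact Real.hasDerivAt_rpow_const (Or.inl ht)
  · exact (Real.hasDerivAt_rpow_const (Or.inl hq)).const_mul p

theorem contDiffAt_norm_sub_sq_rpow {c x : E} (hx : x ≠ c) (p : ℝ) {k : WithTop ℕ∞} :
    ContDiffAt ℝ k (fun y => (‖y - c‖ ^ 2) ^ p) x := by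
  have hq : ‖x - c‖ ^ 2 ≠ 0 := by
    have := norm_pos_iff.2 (sub_ne_zero.2 hx)
    positivity
  exact ((contDiff_id.sub contDiff_const).norm_sq ℝ).contDiffAt.rpow_const_of_ne hq

theorem sq_rpow_neg_half (r : ℝ) (hr : 0 ≤ r) (n : ℕ) :
    (r ^ 2) ^ (-(n : ℝ) / 2) = (r ^ n)⁻¹ := by
  rw [neg_div, Real.rpow_neg (by positivity), ← Real.rpow_natCast r 2, ← Real.rpow_mul hr,
    ← Real.rpow_natCast r n]
  congr 2
  push_cast
  ring

variable [FiniteDimensional ℝ E]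

/-- The Poisson kernel with pole `z` is harmonic in the ball `‖y‖ < ‖z‖`. -/
theorem harmonicOnNhd_poissonKernel (z : E) :
    HarmonicOnNhd (fun y : E => (‖z‖ ^ 2 - ‖y‖ ^ 2) *
      (‖y - z‖ ^ 2) ^ (-(Module.finrank ℝ E : ℝ) / 2)) (ball 0 ‖z‖) := by
  have hne : ∀ y ∈ ball (0 : E) ‖z‖, y ≠ z := by
    rintro y hy rfl
    simp at hy
  intro x hx
  refine ⟨?_, ?_⟩
  · exact ((contDiff_const.sub (contDiff_id.norm_sq ℝ)).contDiffAt).mul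
      (contDiffAt_norm_sub_sq_rpow (hne x hx) _)
  filter_upwards [isOpen_ball.mem_nhds hx] with y hy
  have hyz := hne y hy
  have hqpos : 0 < ‖y - z‖ ^ 2 := by
    have := norm_pos_iff.2 (sub_ne_zero.2 hyz)
    positivity
  have h1 := hasHessianAt_radial (c := 0) (x := y) (g := fun q => ‖z‖ ^ 2 - q)
    (g' := fun _ => -1) (g'' := 0)
    (Eventually.of_forall fun t => by simpa using (hasDerivAt_id t).const_sub (‖z‖ ^ 2))
    (hasDerivAt_const _ _)
  simp only [sub_zero] at h1
  have h2 := (h1.mul (hasHessianAt_norm_sub_sq_rpow hyz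
    (-(Module.finrank ℝ E : ℝ) / 2))).laplacian
  rw [h2]
  set N : ℝ := (Module.finrank ℝ E : ℝ) with hN
  have hsm : ∀ (a b : ℝ) (v w : E), (a • innerSL ℝ v).smulRight (b • innerSL ℝ w) =
      (a * b) • (innerSL ℝ v).smulRight (innerSL ℝ w) := by
    intro a b v w
    ext s t
    simp
    ring
  simp only [bilinTrace_add, bilinTrace_smul, bilinTrace_innerBilin, bilinTrace_smulRight, hsm,
    real_inner_self_eq_norm_sq, Pi.zero_apply, ← hN]
  have hq2 : ‖y - z‖ ^ 2 = ‖y‖ ^ 2 - 2 * inner ℝ y z + ‖z‖ ^ 2 := norm_sub_sq_real y z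
  have hi : inner ℝ y (y - z) = ‖y‖ ^ 2 - inner ℝ y z := by
    rw [inner_sub_right, real_inner_self_eq_norm_sq]
  rw [real_inner_comm y (y - z), hi]
  simp only [Real.rpow_sub_one hqpos.ne']
  set k := (‖y - z‖ ^ 2) ^ (-N / 2)
  rw [hq2] at hqpos ⊢
  field_simp
  ring

end Kernel

/-! ### Integrating `‖y - z‖^{-n}` over a ball. -/

section BallIntegral

variable {E : Type*} [NormedAddCommGroup E] [InnerProductSpace ℝ E] [FiniteDimensional ℝ E]
  [MeasurableSpace E] [BorelSpace E] {μ : Measure E} [μ.IsAddHaarMeasure]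

/-- The mean value property against the weight `(d² - ‖y‖²)⁻¹` on a ball of radius `R < d`. -/
theorem setIntegral_ball_weight_mul_sub_eq_zero {u : E → ℝ} {R d : ℝ}
    (hu : HarmonicOnNhd u (ball 0 d)) (hR : 0 < R) (hRd : R < d) :
    ∫ y in ball 0 R, (d ^ 2 - ‖y‖ ^ 2)⁻¹ * (u y - u 0) ∂μ = 0 := by
  -- Continuous cutoffs converging to the indicator of `q < R²`. The `min` in the denominator keeps
  -- the weight continuous where `d² - q` would vanish, and changes nothing on the ball.
  set φ : ℕ → ℝ → ℝ := fun k q => max 0 (min 1 (k * (R ^ 2 - q))) * (d ^ 2 - min q (R ^ 2))⁻¹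
    with hφ
  have hRd2 : R ^ 2 < d ^ 2 := by gcongr
  have hden : ∀ q, 0 < d ^ 2 - min q (R ^ 2) := fun q => by linarith [min_le_right q (R ^ 2)]
  have hφc : ∀ k, Continuous (φ k) := fun k =>
    (by fun_prop : Continuous fun q => max 0 (min 1 ((k : ℝ) * (R ^ 2 - q)))).mul
      ((by fun_prop : Continuous fun q => d ^ 2 - min q (R ^ 2)).inv₀ fun q => (hden q).ne')
  have hφ0 : ∀ k q, R ^ 2 ≤ q → φ k q = 0 := by
    intro k q hq
    have : (k : ℝ) * (R ^ 2 - q) ≤ 0 :=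
      mul_nonpos_of_nonneg_of_nonpos (by positivity) (by linarith)
    simp only [hφ]
    rw [max_eq_left ((min_le_right _ _).trans this), zero_mul]
  have hφb : ∀ k q, |φ k q| ≤ (d ^ 2 - R ^ 2)⁻¹ := by
    intro k q
    simp only [hφ]
    rw [abs_mul, abs_of_nonneg (le_max_left _ _), abs_of_pos (inv_pos.2 (hden q))]
    calc _ ≤ 1 * (d ^ 2 - R ^ 2)⁻¹ := by
          refine mul_le_mul (max_le zero_le_one (min_le_left _ _))
            (inv_anti₀ (by linarith) ?_) (inv_pos.2 (hden q)).le zero_le_one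
          linarith [min_le_right q (R ^ 2)]
      _ = _ := one_mul _
  have huc : ContinuousOn (fun y => u y - u 0) (closedBall 0 R) :=
    (hu.continuousOn.mono (closedBall_subset_ball hRd)).sub continuousOn_const
  obtain ⟨C, hC⟩ := (isCompact_closedBall (0 : E) R).exists_bound_of_continuousOn huc
  have hzero : ∀ k, ∫ y, φ k (‖y‖ ^ 2) * (u y - u 0) ∂μ = 0 := fun k =>
    integral_radial_mul_sub_eq_zero hu hR.le hRd (hφc k) (hφ0 k)
  have hlim : Tendsto (fun k => ∫ y, φ k (‖y‖ ^ 2) * (u y - u 0) ∂μ) atTop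
      (𝓝 (∫ y, (ball (0 : E) R).indicator
        (fun y => (d ^ 2 - ‖y‖ ^ 2)⁻¹ * (u y - u 0)) y ∂μ)) := by
    refine tendsto_integral_of_dominated_convergence
      ((closedBall (0 : E) R).indicator fun _ => (d ^ 2 - R ^ 2)⁻¹ * C) (fun k => ?_) ?_
      (fun k => Eventually.of_forall fun y => ?_) (Eventually.of_forall fun y => ?_)
    · refine (integrable_of_continuousOn_closedBall (s := R) ?_ fun y hy => ?_).aestronglyMeasurable
      · have := hφc k
        exact (by fun_prop : Continuous fun y : E => φ k (‖y‖ ^ 2)).continuousOn.mul huc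
      · rw [hφ0 k _ (by gcongr), zero_mul]
    · exact (integrable_indicator_iff measurableSet_closedBall).2
        (integrableOn_const (isCompact_closedBall (0 : E) R).measure_lt_top.ne)
    · by_cases hy : y ∈ closedBall (0 : E) R
      · rw [indicator_of_mem hy, norm_mul]
        exact mul_le_mul (hφb k _) (hC y hy) (norm_nonneg _) (inv_nonneg.2 (by linarith))
      · rw [indicator_of_notMem hy, hφ0 k _ (by
          have : R < ‖y‖ := by simpa using hy
          gcongr)]
        simp
    · by_cases hy : y ∈ ball (0 : E) R
      · rw [indicator_of_mem hy]
        have hyR : ‖y‖ ^ 2 < R ^ 2 := by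
          have : ‖y‖ < R := by simpa using hy
          gcongr
        obtain ⟨k₀, hk₀⟩ := exists_nat_ge ((R ^ 2 - ‖y‖ ^ 2)⁻¹)
        refine tendsto_const_nhds.congr' ?_
        filter_upwards [eventually_ge_atTop k₀] with k hk
        have h1 : 1 ≤ (k : ℝ) * (R ^ 2 - ‖y‖ ^ 2) := by
          have hpos : 0 < R ^ 2 - ‖y‖ ^ 2 := by linarith
          have : (R ^ 2 - ‖y‖ ^ 2)⁻¹ ≤ k := hk₀.trans (by exact_mod_cast hk)
          calc (1 : ℝ) = (R ^ 2 - ‖y‖ ^ 2)⁻¹ * (R ^ 2 - ‖y‖ ^ 2) :=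
                (inv_mul_cancel₀ hpos.ne').symm
            _ ≤ _ := by gcongr
        simp only [hφ]
        rw [min_eq_left h1, max_eq_right zero_le_one, one_mul, min_eq_left hyR.le]
      · rw [indicator_of_notMem hy]
        refine tendsto_const_nhds.congr fun k => ?_
        rw [hφ0 k _ (by
          have : R ≤ ‖y‖ := by simpa using hy
          gcongr), zero_mul]
  simp only [hzero] at hlim
  rw [integral_indicator measurableSet_ball] at hlim
  exact (tendsto_nhds_unique hlim tendsto_const_nhds)

/-- The weight `(‖z‖² - ‖y‖²)⁻¹` cancels the numerator of the Poisson kernel, and the value of the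
kernel at the centre is `‖z‖^{2-n}`, with `n` the dimension. -/
theorem setIntegral_ball_inv_norm_sub_pow {z : E} {R : ℝ} (hR : 0 < R) (hRz : R < ‖z‖) :
    ∫ y in ball 0 R, (‖y - z‖ ^ Module.finrank ℝ E)⁻¹ ∂μ =
      ‖z‖ ^ 2 * (‖z‖ ^ Module.finrank ℝ E)⁻¹ * ∫ y in ball 0 R, (‖z‖ ^ 2 - ‖y‖ ^ 2)⁻¹ ∂μ := by
  have h := setIntegral_ball_weight_mul_sub_eq_zero (μ := μ) (harmonicOnNhd_poissonKernel z) hR hRz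
  have hpos : ∀ y ∈ closedBall (0 : E) R, 0 < ‖z‖ ^ 2 - ‖y‖ ^ 2 := by
    intro y hy
    have h1 : ‖y‖ < ‖z‖ := lt_of_le_of_lt (by simpa using hy) hRz
    have : ‖y‖ ^ 2 < ‖z‖ ^ 2 := by gcongr
    linarith
  have hne : ∀ y ∈ closedBall (0 : E) R, ‖y - z‖ ^ Module.finrank ℝ E ≠ 0 := by
    intro y hy
    refine pow_ne_zero _ (norm_ne_zero_iff.2 (sub_ne_zero.2 ?_))
    rintro rfl
    simpa using hpos _ hy
  have hi1 : IntegrableOn (fun y => (‖y - z‖ ^ Module.finrank ℝ E)⁻¹) (ball 0 R) μ :=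
    (ContinuousOn.integrableOn_compact (isCompact_closedBall (0 : E) R)
      (ContinuousOn.inv₀ (by fun_prop) hne)).mono_set ball_subset_closedBall
  have hi2 : IntegrableOn (fun y : E => (‖z‖ ^ 2 - ‖y‖ ^ 2)⁻¹) (ball 0 R) μ :=
    (ContinuousOn.integrableOn_compact (isCompact_closedBall (0 : E) R)
      (ContinuousOn.inv₀ (by fun_prop) fun y hy => (hpos y hy).ne')).mono_set ball_subset_closedBall
  rw [setIntegral_congr_fun (g := fun y => (‖y - z‖ ^ Module.finrank ℝ E)⁻¹ -
    ‖z‖ ^ 2 * (‖z‖ ^ Module.finrank ℝ E)⁻¹ * (‖z‖ ^ 2 - ‖y‖ ^ 2)⁻¹) measurableSet_ball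
    (fun y hy => ?_), integral_sub hi1 (hi2.const_mul _), integral_const_mul] at h
  · exact sub_eq_zero.1 h
  · have := (hpos y (ball_subset_closedBall hy)).ne'
    simp only [sq_rpow_neg_half _ (norm_nonneg _), zero_sub, norm_neg, norm_zero]
    field_simp
    ring

theorem setIntegral_ball_inv_sq_sub_sq {R d : ℝ} (hR : 0 < R) [Nontrivial E] :
    ∫ y in ball (0 : E) R, (d ^ 2 - ‖y‖ ^ 2)⁻¹ ∂μ =
      Module.finrank ℝ E * μ.real (ball 0 1) *
        ∫ t in (0 : ℝ)..R, t ^ (Module.finrank ℝ E - 1) * (d ^ 2 - t ^ 2)⁻¹ := by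
  have h := integral_fun_norm_addHaar μ ((Iio R).indicator fun t => (d ^ 2 - t ^ 2)⁻¹)
  have h1 : ∀ y : E, (Iio R).indicator (fun t => (d ^ 2 - t ^ 2)⁻¹) ‖y‖ =
      (ball (0 : E) R).indicator (fun y => (d ^ 2 - ‖y‖ ^ 2)⁻¹) y := by
    intro y
    by_cases hy : ‖y‖ < R
    · rw [indicator_of_mem (mem_Iio.2 hy), indicator_of_mem (mem_ball_zero_iff.2 hy)]
    · rw [indicator_of_notMem (fun h => hy (mem_Iio.1 h)),
        indicator_of_notMem (fun h => hy (mem_ball_zero_iff.1 h))]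
  simp only [h1] at h
  rw [integral_indicator measurableSet_ball] at h
  rw [h, nsmul_eq_mul, smul_eq_mul, mul_assoc]
  congr 2
  have h2 : ∀ y : ℝ, y ^ (Module.finrank ℝ E - 1) •
      (Iio R).indicator (fun t => (d ^ 2 - t ^ 2)⁻¹) y =
      (Iio R).indicator (fun t => t ^ (Module.finrank ℝ E - 1) * (d ^ 2 - t ^ 2)⁻¹) y := by
    intro y
    simp [indicator_apply]
  simp only [h2]
  rw [setIntegral_indicator measurableSet_Iio, Ioi_inter_Iio, ← integral_Ioc_eq_integral_Ioo,
    ← intervalIntegral.integral_of_le hR.le]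

end BallIntegral

/-! ### Closed form for the potential of a ball. -/

section BallPotential

variable {n : ℕ}

/-- Substitute `μ = (t/d)^n`, for which `μ^{2/n} = (t/d)²`. -/
theorem integral_pow_mul_inv_sq_sub_sq (hn : 0 < n) {R d : ℝ} (hR : 0 < R) (hRd : R < d) :
    n * (d ^ 2 * (d ^ n)⁻¹) * ∫ t in (0 : ℝ)..R, t ^ (n - 1) * (d ^ 2 - t ^ 2)⁻¹ =
      profileTime n ((R / d) ^ n) := by
  have hd : 0 < d := hR.trans hRd
  have hpos : ∀ t ∈ uIcc 0 R, 0 < d ^ 2 - t ^ 2 := by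
    intro t ht
    rw [uIcc_of_le hR.le] at ht
    nlinarith [ht.1, ht.2]
  have hderiv : ∀ t ∈ uIcc 0 R, HasDerivAt (fun t => profileTime n ((t / d) ^ n))
      (n * (d ^ 2 * (d ^ n)⁻¹) * (t ^ (n - 1) * (d ^ 2 - t ^ 2)⁻¹)) t := by
    intro t ht
    have hp := hpos t ht
    rw [uIcc_of_le hR.le] at ht
    have h0 : 0 ≤ t / d := div_nonneg ht.1 hd.le
    have h1 : t / d < 1 := (div_lt_one hd).2 (ht.2.trans_lt hRd)
    have habs : |(t / d) ^ n| < 1 := by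
      rw [abs_of_nonneg (by positivity)]
      exact pow_lt_one₀ h0 h1 hn.ne'
    have hc := (hasDerivAt_profileTime hn habs).comp t (((hasDerivAt_id t).div_const d).pow n)
    refine hc.congr_deriv ?_
    have hsq : |(t / d) ^ n| ^ ((2 : ℝ) / n) = (t / d) ^ 2 := by
      rw [abs_of_nonneg (by positivity), ← Real.rpow_natCast (t / d) n, ← Real.rpow_mul h0,
        ← Real.rpow_natCast (t / d) 2]
      congr 1
      have : (n : ℝ) ≠ 0 := by positivity
      push_cast
      field_simp
    rw [hsq]
    have h2 : (1 - (t / d) ^ 2)⁻¹ = d ^ 2 * (d ^ 2 - t ^ 2)⁻¹ := by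
      have h3 : 1 - (t / d) ^ 2 = (d ^ 2 - t ^ 2) / d ^ 2 := by field_simp
      rw [h3, inv_div, div_eq_mul_inv]
    rw [h2]
    obtain ⟨m, rfl⟩ : ∃ m, n = m + 1 := ⟨n - 1, by omega⟩
    simp only [id, Nat.add_sub_cancel, div_pow, pow_succ]
    field_simp
  rw [← intervalIntegral.integral_const_mul,
    intervalIntegral.integral_eq_sub_of_hasDerivAt hderiv]
  · simp [hn.ne', profileTime_zero]
  · refine ContinuousOn.intervalIntegrable ?_
    exact continuousOn_const.mul ((by fun_prop : Continuous fun t : ℝ =>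
      t ^ (n - 1)).continuousOn.mul (ContinuousOn.inv₀ (by fun_prop) fun t ht => (hpos t ht).ne'))

theorem sphereArea_eq :
    sphereArea n = n * (volume : Measure (EuclideanSpace ℝ (Fin n))).real (ball 0 1) := by
  rw [sphereArea, Measure.toSphere_real_apply_univ, finrank_euclideanSpace_fin]

theorem sphereArea_pos (hn : 0 < n) : 0 < sphereArea n := by
  rw [sphereArea_eq]
  have : 0 < (volume : Measure (EuclideanSpace ℝ (Fin n))).real (ball 0 1) :=
    ENNReal.toReal_pos (measure_ball_pos _ _ one_pos).ne' measure_ball_lt_top.ne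
  positivity

theorem potentialV_congr_ae {ρ σ : EuclideanSpace ℝ (Fin n) → ℝ} (h : ρ =ᵐ[volume] σ) :
    potentialV ρ = potentialV σ := by
  ext x
  rw [potentialV, potentialV]
  congr 1
  refine integral_congr_ae ?_
  filter_upwards [h] with ζ hζ
  rw [hζ]

theorem potentialV_indicator_ball (hn : 0 < n) {c x : EuclideanSpace ℝ (Fin n)} {R : ℝ}
    (hR : 0 < R) (hx : R < ‖x - c‖) :
    potentialV ((ball c R).indicator fun _ => (1 : ℝ)) x =
      profileTime n ((R / ‖x - c‖) ^ n) := by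
  have : Nonempty (Fin n) := ⟨⟨0, hn⟩⟩
  have h1 : ∫ ζ, (ball c R).indicator (fun _ => (1 : ℝ)) ζ / ‖x - ζ‖ ^ n =
      ∫ y in ball (0 : EuclideanSpace ℝ (Fin n)) R, (‖y - (x - c)‖ ^ n)⁻¹ := by
    rw [← integral_indicator measurableSet_ball, ← integral_add_left_eq_self _ c]
    refine integral_congr_ae (Eventually.of_forall fun y => ?_)
    have : x - (c + y) = -(y - (x - c)) := by abel
    beta_reduce
    by_cases hy : ‖y‖ < R
    · have hc : c + y ∈ ball c R := by simpa using hy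
      rw [indicator_of_mem (mem_ball_zero_iff.2 hy), indicator_of_mem hc, this, norm_neg, one_div]
    · have hc : c + y ∉ ball c R := by simpa using hy
      rw [indicator_of_notMem (fun h => hy (mem_ball_zero_iff.1 h)), indicator_of_notMem hc,
        zero_div]
  have h2 := setIntegral_ball_inv_norm_sub_pow
    (μ := (volume : Measure (EuclideanSpace ℝ (Fin n)))) hR hx
  rw [setIntegral_ball_inv_sq_sub_sq hR, finrank_euclideanSpace_fin] at h2
  rw [potentialV, h1, h2, ← integral_pow_mul_inv_sq_sub_sq hn hR hx, ← sphereArea_eq]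
  have := (sphereArea_pos hn).ne'
  field_simp

theorem potentialV_indicator_closedBall (c : EuclideanSpace ℝ (Fin n)) {R : ℝ}
    (hR : 0 < R) : potentialV ((closedBall c R).indicator fun _ => (1 : ℝ)) =
      potentialV ((ball c R).indicator fun _ => (1 : ℝ)) := by
  refine potentialV_congr_ae (indicator_ae_eq_of_ae_eq_set ?_)
  rw [← ball_union_sphere]
  exact union_ae_eq_left_of_ae_eq_empty
    (ae_eq_empty.2 (Measure.addHaar_sphere_of_ne_zero volume c hR.ne'))

end BallPotential

/-! ### Derivatives of the kernel `(‖z‖²)^p` away from the origin. -/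

section Kernel

theorem continuousOn_sub_kernel {E G : Type*} [NormedAddCommGroup E] [TopologicalSpace G]
    {k : E → G} (hk : ContinuousOn k {0}ᶜ) {x : E} {K : Set E} (hx : x ∉ K) :
    ContinuousOn (fun ζ => k (x - ζ)) K := by
  refine hk.comp (by fun_prop) fun ζ hζ => ?_
  rw [mem_compl_singleton_iff, sub_ne_zero]
  rintro rfl
  exact hx hζ

theorem continuousOn_norm_sq_rpow {E : Type*} [NormedAddCommGroup E] (p : ℝ) :
    ContinuousOn (fun z : E => (‖z‖ ^ 2) ^ p) {0}ᶜ := by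
  refine ContinuousOn.rpow_const (by fun_prop) fun z hz => Or.inl ?_
  exact pow_ne_zero _ (norm_ne_zero_iff.2 hz)

variable {E : Type*} [NormedAddCommGroup E] [InnerProductSpace ℝ E]

/-- The derivative of `(‖z‖²) ^ p`. -/
noncomputable def rpowKernelDeriv (p : ℝ) (z : E) : E →L[ℝ] ℝ :=
  (2 * (p * (‖z‖ ^ 2) ^ (p - 1))) • innerSL ℝ z

/-- The second derivative of `(‖z‖²) ^ p`. -/
noncomputable def rpowKernelHess (p : ℝ) (z : E) : E →L[ℝ] E →L[ℝ] ℝ :=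
  (2 * (p * (‖z‖ ^ 2) ^ (p - 1))) • innerBilin E +
    (4 * (p * ((p - 1) * (‖z‖ ^ 2) ^ (p - 1 - 1)))) • (innerSL ℝ z).smulRight (innerSL ℝ z)

theorem hasHessianAt_rpowKernel (p : ℝ) {z : E} (hz : z ≠ 0) :
    HasHessianAt (fun z : E => (‖z‖ ^ 2) ^ p) (rpowKernelDeriv p) (rpowKernelHess p z) z := by
  have h := hasHessianAt_norm_sub_sq_rpow hz p
  simp only [sub_zero] at h
  exact h

theorem continuousOn_rpowKernelDeriv (p : ℝ) :
    ContinuousOn (rpowKernelDeriv p : E → E →L[ℝ] ℝ) {0}ᶜ := fun _ hz =>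
  (hasHessianAt_rpowKernel p hz).second.continuousAt.continuousWithinAt

theorem continuousOn_rpowKernelHess (p : ℝ) :
    ContinuousOn (rpowKernelHess p : E → E →L[ℝ] E →L[ℝ] ℝ) {0}ᶜ := by
  have hs : Continuous fun z : E => (innerSL ℝ z).smulRight (innerSL ℝ z) :=
    ((ContinuousLinearMap.smulRightL ℝ E (E →L[ℝ] ℝ)).continuous.comp
      (innerBilin E).continuous).clm_apply (innerBilin E).continuous
  exact ((continuousOn_const.mul (continuousOn_const.mul
    (continuousOn_norm_sq_rpow _))).smul continuousOn_const).add
    ((continuousOn_const.mul (continuousOn_const.mul (continuousOn_const.mul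
    (continuousOn_norm_sq_rpow _)))).smul hs.continuousOn)

theorem bilinTrace_rpowKernelHess [FiniteDimensional ℝ E] {z : E} (hz : z ≠ 0) :
    bilinTrace (rpowKernelHess (-(Module.finrank ℝ E : ℝ) / 2) z) =
      2 * Module.finrank ℝ E * (‖z‖ ^ 2) ^ (-(Module.finrank ℝ E : ℝ) / 2 - 1) := by
  have hq : ‖z‖ ^ 2 ≠ 0 := pow_ne_zero _ (norm_ne_zero_iff.2 hz)
  rw [rpowKernelHess, bilinTrace_radial, Real.rpow_sub_one hq (_ - 1)]
  field_simp
  ring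

/-- Expanding `f'` in an orthonormal basis reduces its differentiability to that of its components,
so only scalar kernels are differentiated under the integral. -/
theorem hasHessianAt_of_components [FiniteDimensional ℝ E] {f : E → ℝ} {f' : E → E →L[ℝ] ℝ}
    {L : Fin (Module.finrank ℝ E) → E →L[ℝ] ℝ} {x : E}
    (h1 : ∀ᶠ y in 𝓝 x, HasFDerivAt f (f' y) y)
    (h2 : ∀ i, HasFDerivAt (fun y => f' y (stdOrthonormalBasis ℝ E i)) (L i) x) :
    ∃ B, HasHessianAt f f' B x ∧ bilinTrace B = ∑ i, L i (stdOrthonormalBasis ℝ E i) := by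
  set b := stdOrthonormalBasis ℝ E with hb
  refine ⟨∑ i, (L i).smulRight (innerSL ℝ (b i)), ⟨h1, ?_⟩, ?_⟩
  · have hf' : f' = fun y => ∑ i, f' y (b i) • innerSL ℝ (b i) := by
      ext y v
      conv_lhs => rw [← b.sum_repr' v]
      simp only [map_sum, map_smul, smul_eq_mul, _root_.sum_apply, _root_.smul_apply,
        innerSL_apply_apply]
      exact Finset.sum_congr rfl fun i _ => mul_comm _ _
    rw [hf']
    exact HasFDerivAt.fun_sum fun i _ => (h2 i).smul_const (innerSL ℝ (b i) : E →L[ℝ] ℝ)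
  · simp only [bilinTrace, _root_.sum_apply, ContinuousLinearMap.smulRight_apply,
      _root_.smul_apply, innerSL_apply_apply, smul_eq_mul, ← hb,
      orthonormal_iff_ite.1 b.orthonormal, mul_ite, mul_one, mul_zero, Finset.sum_ite_eq',
      Finset.mem_univ, if_true]

end Kernel

/-! ### Integrals of kernels against a density. -/

section Differentiation

variable {n : ℕ} {ρ : EuclideanSpace ℝ (Fin n) → ℝ} {G : Type*} [NormedAddCommGroup G]
  [NormedSpace ℝ G]

theorem IsDensity.integrable_smul (hρ : IsDensity ρ) {g : EuclideanSpace ℝ (Fin n) → G}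
    (hg : ContinuousOn g (tsupport ρ)) : Integrable (fun ζ => ρ ζ • g ζ) := by
  have hK : IsCompact (tsupport ρ) := hρ.hasCompactSupport
  refine (integrableOn_iff_integrable_of_support_subset (s := tsupport ρ) fun y hy => ?_).1 ?_
  · by_contra h
    exact hy (by simp [image_eq_zero_of_notMem_tsupport h])
  · refine (hg.integrableOn_compact hK).bdd_smul 1
      hρ.aemeasurable.aestronglyMeasurable.restrict (Eventually.of_forall fun y => ?_)
    rw [Real.norm_of_nonneg (hρ.nonneg y)]
    exact hρ.le_one y

theorem IsDensity.integrable (hρ : IsDensity ρ) : Integrable ρ := by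
  simpa using hρ.integrable_smul (g := fun _ => (1 : ℝ)) continuousOn_const

/-- Differentiation of a potential under the integral sign, away from the support. -/
theorem IsDensity.hasFDerivAt_potential (hρ : IsDensity ρ) {k : EuclideanSpace ℝ (Fin n) → G}
    {k' : EuclideanSpace ℝ (Fin n) → EuclideanSpace ℝ (Fin n) →L[ℝ] G}
    (hk : ∀ z, z ≠ 0 → HasFDerivAt k (k' z) z) (hk' : ContinuousOn k' {0}ᶜ)
    {x : EuclideanSpace ℝ (Fin n)} (hx : x ∉ tsupport ρ) :
    HasFDerivAt (fun x => ∫ ζ, ρ ζ • k (x - ζ)) (∫ ζ, ρ ζ • k' (x - ζ)) x := by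
  have hkc : ContinuousOn k {0}ᶜ := fun z hz => (hk z hz).continuousAt.continuousWithinAt
  have hopen : IsOpen (tsupport ρ)ᶜ := (isClosed_tsupport ρ).isOpen_compl
  -- A closed ball around `x` missing the support makes the kernel derivative bounded on a compact
  -- product; this is the dominating bound.
  obtain ⟨δ, hδ, hsub⟩ := nhds_basis_closedBall.mem_iff.1 (hopen.mem_nhds hx)
  have hne : ∀ x' ∈ closedBall x δ, ∀ ζ ∈ tsupport ρ, x' - ζ ≠ 0 := by
    intro x' hx' ζ hζ
    rw [sub_ne_zero]
    rintro rfl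
    exact hsub hx' hζ
  have hcont : ContinuousOn (fun p : EuclideanSpace ℝ (Fin n) × EuclideanSpace ℝ (Fin n) =>
      k' (p.1 - p.2)) (closedBall x δ ×ˢ tsupport ρ) :=
    hk'.comp (by fun_prop) fun p hp => hne p.1 hp.1 p.2 hp.2
  obtain ⟨C, hC⟩ := ((isCompact_closedBall x δ).prod
    (show IsCompact (tsupport ρ) from hρ.hasCompactSupport)).exists_bound_of_continuousOn hcont
  refine hasFDerivAt_integral_of_dominated_of_fderiv_le (𝕜 := ℝ)
    (F := fun x ζ => ρ ζ • k (x - ζ)) (F' := fun x ζ => ρ ζ • k' (x - ζ)) (bound := fun ζ => ρ ζ * C)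
    (ball_mem_nhds x hδ) ?_ ?_ ?_ ?_ ?_ ?_
  · filter_upwards [hopen.mem_nhds hx] with x' hx'
    exact (hρ.integrable_smul (continuousOn_sub_kernel hkc hx')).aestronglyMeasurable
  · exact hρ.integrable_smul (continuousOn_sub_kernel hkc hx)
  · exact (hρ.integrable_smul (continuousOn_sub_kernel hk' hx)).aestronglyMeasurable
  · refine Eventually.of_forall fun ζ x' hx' => ?_
    rw [norm_smul, Real.norm_of_nonneg (hρ.nonneg ζ)]
    by_cases hζ : ζ ∈ tsupport ρ
    · exact mul_le_mul_of_nonneg_left (hC (x', ζ) ⟨ball_subset_closedBall hx', hζ⟩) (hρ.nonneg ζ)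
    · simp [image_eq_zero_of_notMem_tsupport hζ]
  · exact hρ.integrable.mul_const C
  · refine Eventually.of_forall fun ζ x' hx' => ?_
    by_cases hζ : ζ ∈ tsupport ρ
    · have h1 := hk (x' - ζ) (hne x' (ball_subset_closedBall hx') ζ hζ)
      have h2 := h1.comp x' ((hasFDerivAt_id x').sub_const ζ)
      exact h2.const_smul (ρ ζ)
    · simpa [image_eq_zero_of_notMem_tsupport hζ] using hasFDerivAt_const (0 : G) x'

end Differentiation

/-- Lets two formulas for the same potential be compared: the integrals `A` and `J` of a ball are
read off from its closed form. -/
theorem HasHessianAt.unique {E : Type*} [NormedAddCommGroup E] [InnerProductSpace ℝ E]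
    {f : E → ℝ} {f' g' : E → E →L[ℝ] ℝ} {B C : E →L[ℝ] E →L[ℝ] ℝ} {x : E}
    (h1 : HasHessianAt f f' B x) (h2 : HasHessianAt f g' C x) : f' x = g' x ∧ B = C := by
  have h : f' =ᶠ[𝓝 x] g' := by
    filter_upwards [h1.first, h2.first] with y a b using a.unique b
  exact ⟨h.self_of_nhds, h1.second.unique (h2.second.congr_of_eventuallyEq h)⟩

/-! ### Gradient and Laplacian of the potential. -/

section PotentialHessian

variable {n : ℕ} {ρ : EuclideanSpace ℝ (Fin n) → ℝ} {x : EuclideanSpace ℝ (Fin n)}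

/-- The vector `∫ ρ(ζ) (ζ - x) |ζ - x|^{-n-2} dζ`, a multiple of the gradient of the potential. -/
noncomputable def potentialGrad (ρ : EuclideanSpace ℝ (Fin n) → ℝ)
    (x : EuclideanSpace ℝ (Fin n)) : EuclideanSpace ℝ (Fin n) :=
  ∫ ζ, ρ ζ • (‖x - ζ‖ ^ 2) ^ (-(n : ℝ) / 2 - 1) • (ζ - x)

/-- The integral `∫ ρ(ζ) |ζ - x|^{-n-2} dζ`, a multiple of the Laplacian of the potential. -/
noncomputable def potentialLap (ρ : EuclideanSpace ℝ (Fin n) → ℝ)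
    (x : EuclideanSpace ℝ (Fin n)) : ℝ :=
  ∫ ζ, ρ ζ • (‖x - ζ‖ ^ 2) ^ (-(n : ℝ) / 2 - 1)

theorem IsDensity.exists_hasHessianAt_potentialV (hρ : IsDensity ρ) (hx : x ∉ tsupport ρ) :
    ∃ V' B, HasHessianAt (potentialV ρ) V' B x ∧
      V' x = innerSL ℝ ((n * (n / sphereArea n)) • potentialGrad ρ x) ∧
      bilinTrace B = 2 * n * (n / sphereArea n) * potentialLap ρ x := by
  set p : ℝ := -(n : ℝ) / 2 with hp
  set c : ℝ := n / sphereArea n with hc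
  have hd1 : ∀ z : EuclideanSpace ℝ (Fin n), z ≠ 0 →
      HasFDerivAt (fun z : EuclideanSpace ℝ (Fin n) => (‖z‖ ^ 2) ^ p) (rpowKernelDeriv p z) z :=
    fun z hz => (hasHessianAt_rpowKernel p hz).first.self_of_nhds
  -- Differentiating the component along `v` puts `v` in the second slot; symmetry of the Hessian
  -- moves it to the first.
  have hd2 : ∀ v z : EuclideanSpace ℝ (Fin n), z ≠ 0 →
      HasFDerivAt (fun z => rpowKernelDeriv p z v) (rpowKernelHess p z v) z := by
    intro v z hz
    have h := (hasHessianAt_rpowKernel p hz).second.clm_apply (hasFDerivAt_const v z)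
    refine h.congr_fderiv ?_
    ext w
    simp [rpowKernelHess, innerBilin_apply, real_inner_comm]
    left
    ring
  have hc2 : ∀ v : EuclideanSpace ℝ (Fin n),
      ContinuousOn (fun z => rpowKernelHess p z v) {0}ᶜ := fun v =>
    (continuousOn_rpowKernelHess p).clm_apply continuousOn_const
  have hV : potentialV ρ = c • fun x => ∫ ζ, ρ ζ • (‖x - ζ‖ ^ 2) ^ p := by
    ext y
    simp only [potentialV, Pi.smul_apply, smul_eq_mul, hp, sq_rpow_neg_half _ (norm_nonneg _),
      div_eq_mul_inv (ρ _), hc]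
  have hx' : ∀ᶠ y in 𝓝 x, y ∉ tsupport ρ := (isClosed_tsupport ρ).isOpen_compl.mem_nhds hx
  have hi1 : ∀ y, y ∉ tsupport ρ → Integrable fun ζ => ρ ζ • rpowKernelDeriv p (y - ζ) :=
    fun y hy => hρ.integrable_smul (continuousOn_sub_kernel (continuousOn_rpowKernelDeriv p) hy)
  have hfirst : ∀ᶠ y in 𝓝 x, HasFDerivAt (potentialV ρ)
      (c • ∫ ζ, ρ ζ • rpowKernelDeriv p (y - ζ)) y := by
    filter_upwards [hx'] with y hy
    rw [hV]
    exact (hρ.hasFDerivAt_potential hd1 (continuousOn_rpowKernelDeriv p) hy).const_smul c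
  obtain ⟨B, hB, htr⟩ := hasHessianAt_of_components hfirst
    (L := fun i => c • ∫ ζ, ρ ζ • rpowKernelHess p (x - ζ) (stdOrthonormalBasis ℝ _ i))
    (fun i => by
      have h := (hρ.hasFDerivAt_potential (hd2 (stdOrthonormalBasis ℝ _ i)) (hc2 _) hx).const_smul c
      refine h.congr_of_eventuallyEq ?_
      filter_upwards [hx'] with y hy
      rw [_root_.smul_apply, ContinuousLinearMap.integral_apply (hi1 y hy)]
      rfl)
  refine ⟨_, B, hB, ?_, ?_⟩
  · have hi : Integrable fun ζ => ρ ζ • (‖x - ζ‖ ^ 2) ^ (p - 1) • (ζ - x) :=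
      hρ.integrable_smul ((continuousOn_sub_kernel (continuousOn_norm_sq_rpow _) hx).smul
        (continuousOn_id.sub continuousOn_const))
    have h1 : innerBilin _ (potentialGrad ρ x) =
        ∫ ζ, innerBilin _ (ρ ζ • (‖x - ζ‖ ^ 2) ^ (p - 1) • (ζ - x)) :=
      ((innerBilin _).integral_comp_comm hi).symm
    have h2 : ∀ ζ, ρ ζ • rpowKernelDeriv p (x - ζ) =
        (n : ℝ) • innerBilin _ (ρ ζ • (‖x - ζ‖ ^ 2) ^ (p - 1) • (ζ - x)) := by
      intro ζ
      ext v
      simp only [rpowKernelDeriv, innerBilin_apply, innerSL_apply_apply, inner_smul_left,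
        inner_sub_left, _root_.smul_apply, smul_eq_mul, conj_trivial]
      rw [hp]
      ring
    change c • ∫ ζ, ρ ζ • rpowKernelDeriv p (x - ζ) = innerBilin _ ((n * c) • potentialGrad ρ x)
    simp only [h2]
    rw [integral_smul, ← h1, map_smul, smul_smul, mul_comm c]
  · have h4 : ∀ ζ, bilinTrace (ρ ζ • rpowKernelHess p (x - ζ)) =
        2 * n * (ρ ζ • (‖x - ζ‖ ^ 2) ^ (-(n : ℝ) / 2 - 1)) := by
      intro ζ
      rw [bilinTrace_smul]
      by_cases hz : ρ ζ = 0
      · simp [hz]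
      · have hne : x - ζ ≠ 0 := fun h => hz
          (image_eq_zero_of_notMem_tsupport ((sub_eq_zero.1 h) ▸ hx))
        have := bilinTrace_rpowKernelHess hne
        rw [finrank_euclideanSpace_fin] at this
        rw [hp, this, smul_eq_mul]
        ring
    have hi2 : ∀ v, Integrable fun ζ => ρ ζ • rpowKernelHess p (x - ζ) v := fun v =>
      hρ.integrable_smul (continuousOn_sub_kernel (hc2 v) hx)
    have h5 : ∀ v, (c • ∫ ζ, ρ ζ • rpowKernelHess p (x - ζ) v) v =
        c * ∫ ζ, (ρ ζ • rpowKernelHess p (x - ζ)) v v := by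
      intro v
      rw [_root_.smul_apply, ContinuousLinearMap.integral_apply (hi2 v)]
      rfl
    have hi3 : ∀ v, Integrable fun ζ => (ρ ζ • rpowKernelHess p (x - ζ)) v v := fun v =>
      (hi2 v).apply_continuousLinearMap v
    rw [htr]
    simp only [h5]
    rw [← Finset.mul_sum, ← integral_finsetSum _ fun i _ => hi3 _]
    change c * ∫ ζ, bilinTrace (ρ ζ • rpowKernelHess p (x - ζ)) = _
    simp only [h4]
    rw [integral_const_mul, potentialLap]
    ring

end PotentialHessian

/-! ### The integrals `A` and `J` for a ball. -/

section BallDensity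

variable {n : ℕ}

theorem tsupport_indicator_ball_subset (c : EuclideanSpace ℝ (Fin n)) (R : ℝ) :
    tsupport ((ball c R).indicator fun _ => (1 : ℝ)) ⊆ closedBall c R :=
  closure_minimal (support_indicator_subset.trans ball_subset_closedBall) isClosed_closedBall

theorem isDensity_indicator_ball (c : EuclideanSpace ℝ (Fin n)) (R : ℝ) :
    IsDensity ((ball c R).indicator fun _ => (1 : ℝ)) where
  aemeasurable := (measurable_const.indicator measurableSet_ball).aemeasurable
  nonneg := indicator_nonneg fun _ _ => zero_le_one
  le_one := indicator_le_self' (fun _ _ => zero_le_one)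
  hasCompactSupport := HasCompactSupport.intro (isCompact_closedBall c R) fun _ hx =>
    indicator_of_notMem (fun h => hx (ball_subset_closedBall h)) _

/-- With `m = R^n q^{-n/2}` one has `m^{2/n} = R²/q`, so the derivative is elementary although
`profileTime` is not. -/
theorem hasDerivAt_profileTime_radial (hn : 0 < n) {R q : ℝ} (hR : 0 < R) (hq : R ^ 2 < q) :
    HasDerivAt (fun q => profileTime n (R ^ n * q ^ (-(n : ℝ) / 2)))
      (-(n : ℝ) / 2 * R ^ n * (q ^ (-(n : ℝ) / 2) / (q - R ^ 2))) q := by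
  have hq0 : 0 < q := lt_trans (by positivity) hq
  have hn0 : (n : ℝ) ≠ 0 := by positivity
  have hnn : 0 ≤ R ^ n * q ^ (-(n : ℝ) / 2) := by positivity
  have hpow : (R ^ n * q ^ (-(n : ℝ) / 2)) ^ ((2 : ℝ) / n) = R ^ 2 / q := by
    rw [Real.mul_rpow (by positivity) (by positivity), ← Real.rpow_natCast R n,
      ← Real.rpow_mul hR.le, ← Real.rpow_mul hq0.le]
    have h1 : (n : ℝ) * (2 / n) = (2 : ℕ) := by push_cast; field_simp
    have h2 : -(n : ℝ) / 2 * (2 / n) = -1 := by field_simp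
    rw [h1, h2, Real.rpow_natCast, Real.rpow_neg_one, div_eq_mul_inv]
  have hlt : R ^ n * q ^ (-(n : ℝ) / 2) < 1 := by
    by_contra! h
    have := Real.one_le_rpow h (by positivity : (0 : ℝ) ≤ 2 / n)
    rw [hpow, one_le_div hq0] at this
    linarith
  have h1 := hasDerivAt_profileTime hn (by rwa [abs_of_nonneg hnn])
  have h2 : HasDerivAt (fun q : ℝ => R ^ n * q ^ (-(n : ℝ) / 2))
      (R ^ n * (-(n : ℝ) / 2 * q ^ (-(n : ℝ) / 2 - 1))) q :=
    (Real.hasDerivAt_rpow_const (Or.inl hq0.ne')).const_mul _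
  refine (h1.comp q h2).congr_deriv ?_
  rw [abs_of_nonneg hnn, hpow, Real.rpow_sub_one hq0.ne']
  have h3 : q - R ^ 2 ≠ 0 := by linarith
  have h4 : 1 - R ^ 2 / q = (q - R ^ 2) / q := by field_simp
  rw [h4]
  field_simp

/-- Near `x` the potential is an explicit function of `‖y - c‖²`; equating its derivatives with the
integral formulas avoids evaluating either integral directly. -/
theorem potentialGrad_potentialLap_indicator_ball (hn : 0 < n) {c x : EuclideanSpace ℝ (Fin n)}
    {R : ℝ} (hR : 0 < R) (hx : R < ‖x - c‖) :
    potentialGrad ((ball c R).indicator fun _ => (1 : ℝ)) x =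
        (sphereArea n / n * ((R / ‖x - c‖) ^ n / (‖x - c‖ ^ 2 - R ^ 2))) • (c - x) ∧
      potentialLap ((ball c R).indicator fun _ => (1 : ℝ)) x =
        sphereArea n / n *
          ((R / ‖x - c‖) ^ n * ‖x - c‖ ^ 2 / (‖x - c‖ ^ 2 - R ^ 2) ^ 2) := by
  have hxs : x ∉ tsupport ((ball c R).indicator fun _ => (1 : ℝ)) := fun h => by
    have := tsupport_indicator_ball_subset c R h
    rw [mem_closedBall, dist_eq_norm] at this
    linarith
  have hpow : ∀ y : EuclideanSpace ℝ (Fin n), (R / ‖y - c‖) ^ n =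
      R ^ n * (‖y - c‖ ^ 2) ^ (-(n : ℝ) / 2) := fun y => by
    rw [sq_rpow_neg_half _ (norm_nonneg _), div_pow, div_eq_mul_inv]
  obtain ⟨V', B, hB, hV', htr⟩ :=
    (isDensity_indicator_ball c R).exists_hasHessianAt_potentialV hxs
  have hq : R ^ 2 < ‖x - c‖ ^ 2 := by gcongr
  have hq0 : 0 < ‖x - c‖ ^ 2 := lt_trans (by positivity) hq
  have hqR : ‖x - c‖ ^ 2 - R ^ 2 ≠ 0 := by linarith
  have hn0 : (n : ℝ) ≠ 0 := by positivity
  have hω := (sphereArea_pos hn).ne'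
  have hrad := hasHessianAt_radial (c := c) (x := x)
    (g := fun q => profileTime n (R ^ n * q ^ (-(n : ℝ) / 2)))
    (g' := fun q => -(n : ℝ) / 2 * R ^ n * (q ^ (-(n : ℝ) / 2) / (q - R ^ 2)))
    (by
      filter_upwards [isOpen_Ioi.mem_nhds hq] with q hq
      exact hasDerivAt_profileTime_radial hn hR hq)
    (((Real.hasDerivAt_rpow_const (Or.inl hq0.ne')).fun_div
      ((hasDerivAt_id _).sub_const (R ^ 2)) hqR).const_mul _)
  have hV : potentialV ((ball c R).indicator fun _ => (1 : ℝ)) =ᶠ[𝓝 x]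
      fun y => profileTime n (R ^ n * (‖y - c‖ ^ 2) ^ (-(n : ℝ) / 2)) := by
    have ho : IsOpen {y : EuclideanSpace ℝ (Fin n) | R < ‖y - c‖} :=
      isOpen_lt continuous_const (by fun_prop)
    filter_upwards [ho.mem_nhds hx] with y hy
    rw [potentialV_indicator_ball hn hR hy, hpow]
  obtain ⟨h1, h2⟩ := hB.unique (hrad.congr hV)
  have hpx := hpow x
  have hk : (‖x - c‖ ^ 2) ^ (-(n : ℝ) / 2) = (R / ‖x - c‖) ^ n / R ^ n := by
    rw [hpx]
    field_simp
  constructor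
  · refine ext_inner_right ℝ fun v => ?_
    have h3 := DFunLike.congr_fun (hV'.symm.trans h1) v
    simp only [innerSL_apply_apply, inner_smul_left, _root_.smul_apply, smul_eq_mul, conj_trivial,
      hk] at h3
    rw [inner_smul_left, conj_trivial, ← neg_sub x c, inner_neg_left]
    have h4 : inner ℝ (potentialGrad ((ball c R).indicator fun _ => (1 : ℝ)) x) v =
        sphereArea n / (n * n) * (n * (n / sphereArea n) *
          inner ℝ (potentialGrad ((ball c R).indicator fun _ => (1 : ℝ)) x) v) := by
      field_simp
    rw [h4, h3]
    field_simp
  · rw [h2, bilinTrace_radial, finrank_euclideanSpace_fin, Real.rpow_sub_one hq0.ne', hk] at htr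
    simp only [id] at htr
    have h4 : potentialLap ((ball c R).indicator fun _ => (1 : ℝ)) x =
        sphereArea n / (2 * n * n) * (2 * n * (n / sphereArea n) *
          potentialLap ((ball c R).indicator fun _ => (1 : ℝ)) x) := by
      field_simp
    rw [h4, ← htr]
    have hx0 : ‖x - c‖ ≠ 0 := (hR.trans hx).ne'
    generalize (R / ‖x - c‖) ^ n = k
    field_simp
    ring

end BallDensity

/-! ### The bathtub comparison and the sharp gradient estimate. -/

section KeyInequality

variable {n : ℕ} {ρ : EuclideanSpace ℝ (Fin n) → ℝ} {x : EuclideanSpace ℝ (Fin n)}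

theorem IsDensity.integrable_quadratic (hρ : IsDensity ρ) (hx : x ∉ tsupport ρ)
    (v : EuclideanSpace ℝ (Fin n)) (β : ℝ) :
    Integrable fun ζ => ρ ζ • ((‖x - ζ‖ ^ 2) ^ (-(n : ℝ) / 2 - 1) *
      (1 - 2 * inner ℝ v (ζ - x) + β * ‖x - ζ‖ ^ 2)) :=
  hρ.integrable_smul ((continuousOn_sub_kernel (continuousOn_norm_sq_rpow _) hx).mul
    (by fun_prop))

/-- The factor `‖x - ζ‖²` lowers the weight to `‖x - ζ‖^{-n}`, so the last term depends on `ρ` only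
through its potential at `x`. -/
theorem IsDensity.integral_quadratic (hn : 0 < n) (hρ : IsDensity ρ) (hx : x ∉ tsupport ρ)
    (v : EuclideanSpace ℝ (Fin n)) (β : ℝ) :
    ∫ ζ, ρ ζ • ((‖x - ζ‖ ^ 2) ^ (-(n : ℝ) / 2 - 1) *
      (1 - 2 * inner ℝ v (ζ - x) + β * ‖x - ζ‖ ^ 2)) =
    potentialLap ρ x - 2 * inner ℝ v (potentialGrad ρ x) +
      β * (sphereArea n / n * potentialV ρ x) := by
  have hw := continuousOn_sub_kernel
    (continuousOn_norm_sq_rpow (E := EuclideanSpace ℝ (Fin n)) (-(n : ℝ) / 2 - 1)) hx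
  have hi1 : Integrable fun ζ => ρ ζ • (‖x - ζ‖ ^ 2) ^ (-(n : ℝ) / 2 - 1) := hρ.integrable_smul hw
  have hi2 : Integrable fun ζ => ρ ζ • (‖x - ζ‖ ^ 2) ^ (-(n : ℝ) / 2 - 1) • (ζ - x) :=
    hρ.integrable_smul (hw.smul (continuousOn_id.sub continuousOn_const))
  have hi3 : Integrable fun ζ => ρ ζ / ‖x - ζ‖ ^ n := by
    have := hρ.integrable_smul (continuousOn_sub_kernel
      (continuousOn_norm_sq_rpow (E := EuclideanSpace ℝ (Fin n)) (-(n : ℝ) / 2)) hx)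
    simpa only [sq_rpow_neg_half _ (norm_nonneg _), smul_eq_mul, ← div_eq_mul_inv] using this
  have hpt : ∀ ζ, ρ ζ • ((‖x - ζ‖ ^ 2) ^ (-(n : ℝ) / 2 - 1) *
      (1 - 2 * inner ℝ v (ζ - x) + β * ‖x - ζ‖ ^ 2)) =
      ρ ζ • (‖x - ζ‖ ^ 2) ^ (-(n : ℝ) / 2 - 1) -
      2 * inner ℝ v (ρ ζ • (‖x - ζ‖ ^ 2) ^ (-(n : ℝ) / 2 - 1) • (ζ - x)) +
      β * (ρ ζ / ‖x - ζ‖ ^ n) := by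
    intro ζ
    by_cases hζ : ρ ζ = 0
    · simp [hζ]
    · have hne : x - ζ ≠ 0 := fun h => hζ
        (image_eq_zero_of_notMem_tsupport ((sub_eq_zero.1 h) ▸ hx))
      have hq : ‖x - ζ‖ ^ 2 ≠ 0 := pow_ne_zero _ (norm_ne_zero_iff.2 hne)
      rw [div_eq_mul_inv (ρ ζ), ← sq_rpow_neg_half _ (norm_nonneg _) n, Real.rpow_sub_one hq]
      simp only [smul_eq_mul, inner_smul_right]
      field_simp
  simp only [hpt]
  have hi4 : Integrable fun ζ =>
      2 * inner ℝ v (ρ ζ • (‖x - ζ‖ ^ 2) ^ (-(n : ℝ) / 2 - 1) • (ζ - x)) :=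
    (hi2.const_inner v).const_mul 2
  have hi5 : Integrable fun ζ => ρ ζ • (‖x - ζ‖ ^ 2) ^ (-(n : ℝ) / 2 - 1) -
      2 * inner ℝ v (ρ ζ • (‖x - ζ‖ ^ 2) ^ (-(n : ℝ) / 2 - 1) • (ζ - x)) := hi1.sub hi4
  rw [integral_add hi5 (hi3.const_mul β),
    integral_sub hi1 hi4, integral_const_mul, integral_const_mul,
    integral_inner hi2, potentialV]
  have hn0 : (n : ℝ) ≠ 0 := by positivity
  have hω := (sphereArea_pos hn).ne'
  simp only [potentialLap, potentialGrad]
  congr 2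
  field_simp

theorem potentialLap_nonneg (hρ : IsDensity ρ) : 0 ≤ potentialLap ρ x :=
  integral_nonneg fun ζ => mul_nonneg (hρ.nonneg ζ) (by positivity)

/-- Comparison of a density with the ball of the same potential at `x`. -/
theorem IsDensity.quadratic_ineq (hn : 2 ≤ n) (hρ : IsDensity ρ) (hx : x ∉ tsupport ρ)
    {e : EuclideanSpace ℝ (Fin n)} (he : ‖e‖ = 1) {s a : ℝ} (hs0 : 0 < s) (hs1 : s < 1)
    (ha : 0 < a) (hV : potentialV ρ x = profileTime n (s ^ n)) :
    0 ≤ potentialLap ρ x - 2 * a * inner ℝ e (potentialGrad ρ x) +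
      sphereArea n / n * s ^ n * a ^ 2 := by
  have hn0 : 0 < n := by omega
  have hs2 : 0 < 1 - s ^ 2 := by nlinarith
  -- With centre at distance `1/b` and radius `s/b`, the potential at `x` is `profileTime n (s ^ n)`
  -- for every `b`. The factor `1 - s²` makes `‖x - c‖² - R² = 1/(ab)`, so that the quadratic equals
  -- `ab(‖ζ - c‖² - R²)`.
  set b : ℝ := a * (1 - s ^ 2) with hb
  have hb0 : 0 < b := by positivity
  set c := x + b⁻¹ • e with hc
  set R : ℝ := s / b with hR
  have hR0 : 0 < R := by positivity
  have hcx : c - x = b⁻¹ • e := by simp [hc]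
  have hnorm : ‖x - c‖ = b⁻¹ := by
    rw [← norm_neg, neg_sub, hcx, norm_smul, he, mul_one, Real.norm_of_nonneg (by positivity)]
  have hRx : R < ‖x - c‖ := by
    rw [hnorm, hR, div_eq_mul_inv]
    exact mul_lt_of_lt_one_left (by positivity) hs1
  have hratio : R / ‖x - c‖ = s := by
    rw [hnorm, hR]
    field_simp
  set χ : EuclideanSpace ℝ (Fin n) → ℝ := (ball c R).indicator fun _ => (1 : ℝ) with hχ
  have hD : IsDensity χ := isDensity_indicator_ball c R
  have hxD : x ∉ tsupport χ := fun h => by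
    have := tsupport_indicator_ball_subset c R h
    rw [mem_closedBall, dist_eq_norm] at this
    linarith
  have hVD : potentialV χ x = potentialV ρ x := by
    rw [potentialV_indicator_ball hn0 hR0 hRx, hratio, hV]
  obtain ⟨hG, hL⟩ := potentialGrad_potentialLap_indicator_ball hn0 hR0 hRx
  -- Pointwise: where the quadratic is nonpositive, `ρ ≤ 1 = χ`; elsewhere `ρ ≥ 0 = χ`.
  have hmono : ∫ ζ, χ ζ • ((‖x - ζ‖ ^ 2) ^ (-(n : ℝ) / 2 - 1) *
      (1 - 2 * inner ℝ (a • e) (ζ - x) + a * b * ‖x - ζ‖ ^ 2)) ≤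
      ∫ ζ, ρ ζ • ((‖x - ζ‖ ^ 2) ^ (-(n : ℝ) / 2 - 1) *
      (1 - 2 * inner ℝ (a • e) (ζ - x) + a * b * ‖x - ζ‖ ^ 2)) := by
    refine integral_mono (hD.integrable_quadratic hxD _ _) (hρ.integrable_quadratic hx _ _)
      fun ζ => ?_
    have hQ : 1 - 2 * inner ℝ (a • e) (ζ - x) + a * b * ‖x - ζ‖ ^ 2 =
        a * b * (‖ζ - c‖ ^ 2 - R ^ 2) := by
      have h1 : ζ - c = (ζ - x) - b⁻¹ • e := by rw [hc]; abel
      rw [h1, norm_sub_sq_real (ζ - x), norm_smul, he, inner_smul_right, inner_smul_left,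
        Real.norm_of_nonneg (by positivity : 0 ≤ b⁻¹), norm_sub_rev x ζ, real_inner_comm, hR]
      simp only [conj_trivial]
      field_simp
      rw [hb]
      ring
    have hw : 0 ≤ (‖x - ζ‖ ^ 2) ^ (-(n : ℝ) / 2 - 1) := by positivity
    have hab : 0 < a * b := by positivity
    simp only [smul_eq_mul]
    rw [hQ]
    by_cases hζ : ζ ∈ ball c R
    · have h1 : χ ζ = 1 := indicator_of_mem hζ _
      have h2 : ‖ζ - c‖ ^ 2 - R ^ 2 ≤ 0 := by
        rw [mem_ball, dist_eq_norm] at hζ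
        have : ‖ζ - c‖ ^ 2 < R ^ 2 := by gcongr
        linarith
      rw [h1]
      refine mul_le_mul_of_nonpos_right (hρ.le_one ζ) ?_
      exact mul_nonpos_of_nonneg_of_nonpos hw (mul_nonpos_of_nonneg_of_nonpos hab.le h2)
    · have h1 : χ ζ = 0 := indicator_of_notMem hζ _
      have h2 : 0 ≤ ‖ζ - c‖ ^ 2 - R ^ 2 := by
        rw [mem_ball, dist_eq_norm, not_lt] at hζ
        have : R ^ 2 ≤ ‖ζ - c‖ ^ 2 := by gcongr
        linarith
      rw [h1, zero_mul]
      have := hρ.nonneg ζ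
      positivity
  rw [hD.integral_quadratic hn0 hxD, hρ.integral_quadratic hn0 hx, hVD, hG, hL, hratio, hnorm,
    hcx] at hmono
  have hden : b⁻¹ ^ 2 - R ^ 2 = (1 - s ^ 2) / b ^ 2 := by
    rw [hR]
    field_simp
  simp only [inner_smul_left, inner_smul_right, conj_trivial, real_inner_self_eq_norm_sq, he,
    hden] at hmono
  have e1 : s ^ n * b⁻¹ ^ 2 / ((1 - s ^ 2) / b ^ 2) ^ 2 = s ^ n * a ^ 2 := by
    rw [hb]
    field_simp
  have e2 : sphereArea n / n * (s ^ n / ((1 - s ^ 2) / b ^ 2)) * (b⁻¹ * (a * 1 ^ 2)) =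
      sphereArea n / n * (s ^ n * a ^ 2) := by
    rw [hb]
    field_simp
  rw [e1, e2] at hmono
  linarith

/-- The sharp gradient estimate for the potential. -/
theorem IsDensity.gradient_ineq (hn : 2 ≤ n) (hρ : IsDensity ρ) (hx : x ∉ tsupport ρ)
    {M : ℝ → ℝ} (hM : IsProfile n M) (hV : 0 < potentialV ρ x) :
    n / sphereArea n * ‖potentialGrad ρ x‖ ^ 2 ≤ M (potentialV ρ x) * potentialLap ρ x := by
  have hn0 : 0 < n := by omega
  have hω := sphereArea_pos hn0
  set m := M (potentialV ρ x) with hm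
  have hm0 : 0 < m := hM.pos hn hV
  have hm1 : m < 1 := hM.lt_one hn hV.le
  by_cases hA : potentialGrad ρ x = 0
  · rw [hA, norm_zero]
    have := potentialLap_nonneg (x := x) hρ
    simpa using by positivity
  have hα : 0 < ‖potentialGrad ρ x‖ := norm_pos_iff.2 hA
  set α := ‖potentialGrad ρ x‖ with hαdef
  set s := m ^ ((1 : ℝ) / n) with hs
  have hsn : s ^ n = m := by
    rw [hs, ← Real.rpow_natCast, ← Real.rpow_mul hm0.le, one_div, inv_mul_cancel₀ (by positivity),
      Real.rpow_one]
  have hs0 : 0 < s := by positivity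
  have hs1 : s < 1 := Real.rpow_lt_one hm0.le hm1 (by positivity)
  have hn' : (0 : ℝ) < n := by positivity
  -- The direction is that of `A`, and this `a` minimises `J - 2a|A| + (ω_n/n) m a²`.
  have key := hρ.quadratic_ineq hn hx (e := α⁻¹ • potentialGrad ρ x)
    (by rw [norm_smul, Real.norm_of_nonneg (by positivity), inv_mul_cancel₀ hα.ne']) hs0 hs1
    (a := n / sphereArea n * α / m) (by positivity)
    (by rw [hsn, hm, hM.profileTime_eq hn hV.le])
  rw [hsn, inner_smul_left, real_inner_self_eq_norm_sq, ← hαdef] at key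
  simp only [conj_trivial] at key
  have e1 : 2 * (n / sphereArea n * α / m) * (α⁻¹ * α ^ 2) =
      2 * (n / sphereArea n * α ^ 2 / m) := by
    field_simp
  have e2 : sphereArea n / n * m * (n / sphereArea n * α / m) ^ 2 =
      n / sphereArea n * α ^ 2 / m := by
    field_simp
  rw [e1, e2] at key
  have : n / sphereArea n * α ^ 2 / m ≤ potentialLap ρ x := by linarith
  rw [div_le_iff₀ hm0] at this
  linarith

end KeyInequality

/-! ### Fundamental solutions of the Laplacian. -/

section RadialHarmonic

variable {E : Type*} [NormedAddCommGroup E] [InnerProductSpace ℝ E] [FiniteDimensional ℝ E]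

/-- The Newtonian kernel `‖y - c‖ ^ (2 - N)` is harmonic away from its pole. -/
theorem harmonicAt_norm_sub_sq_rpow {c x : E} (hx : x ≠ c) :
    HarmonicAt (fun y => (‖y - c‖ ^ 2) ^ (1 - (Module.finrank ℝ E : ℝ) / 2)) x := by
  refine ⟨contDiffAt_norm_sub_sq_rpow hx _, ?_⟩
  filter_upwards [isOpen_ne.mem_nhds hx] with y hy
  have hr : ‖y - c‖ ≠ 0 := norm_ne_zero_iff.2 (sub_ne_zero.2 hy)
  have hq : ‖y - c‖ ^ 2 ≠ 0 := pow_ne_zero _ hr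
  rw [(hasHessianAt_norm_sub_sq_rpow hy _).laplacian, bilinTrace_radial,
    Real.rpow_sub_one hq (_ - 1), Pi.zero_apply]
  field_simp
  ring

/-- In dimension two, the logarithmic kernel is harmonic away from its pole. -/
theorem harmonicAt_log_norm_sub_sq (hE : Module.finrank ℝ E = 2) {c x : E} (hx : x ≠ c) :
    HarmonicAt (fun y => Real.log (‖y - c‖ ^ 2)) x := by
  have hq : ∀ y, y ≠ c → ‖y - c‖ ^ 2 ≠ 0 := fun y hy =>
    pow_ne_zero _ (norm_ne_zero_iff.2 (sub_ne_zero.2 hy))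
  refine ⟨((contDiff_id.sub contDiff_const).norm_sq ℝ).contDiffAt.log (hq x hx), ?_⟩
  filter_upwards [isOpen_ne.mem_nhds hx] with y hy
  have hqy := hq y hy
  have h := hasHessianAt_radial (c := c) (x := y) (g := Real.log) (g' := fun q => q⁻¹)
    (by
      filter_upwards [isOpen_ne.mem_nhds hqy] with t ht
      exact Real.hasDerivAt_log ht) (hasDerivAt_inv hqy)
  rw [h.laplacian, bilinTrace_radial, hE, Pi.zero_apply]
  push_cast
  generalize ‖y - c‖ ^ 2 = q at hqy
  field_simp
  ring

end RadialHarmonic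

/-! ### Subharmonicity in general and harmonicity for balls. -/

section Subharmonic

variable {n : ℕ}

/-- Subtracting a harmonic majorant does not change the Laplacian, so the weak maximum principle
applies to the difference. -/
theorem subharmonicOn_of_hessian_trace_nonneg (hn : 0 < n) {u : EuclideanSpace ℝ (Fin n) → ℝ}
    {U : Set (EuclideanSpace ℝ (Fin n))}
    (hu : ∀ x ∈ U, ∃ u' B, HasHessianAt u u' B x ∧ 0 ≤ bilinTrace B) : SubharmonicOn u U := by
  have : Nonempty (Fin n) := ⟨⟨0, hn⟩⟩
  have hc : ContinuousOn u U := fun x hx => by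
    obtain ⟨u', B, h, -⟩ := hu x hx
    exact h.continuousAt.continuousWithinAt
  refine ⟨hc.upperSemicontinuousOn, fun x r hr hsub h hhc hh hle y hy => ?_⟩
  have := nonpos_of_hessian_trace_nonneg (w := u - h) hr ((hc.mono hsub).sub hhc)
    (fun z hz => by
      obtain ⟨u', B, hB, htr⟩ := hu z (hsub (ball_subset_closedBall hz))
      have h1 := (hh z hz).1.hasHessianAt
      have h2 := h1.laplacian
      rw [(hh z hz).2.self_of_nhds, Pi.zero_apply] at h2
      exact ⟨_, _, hB.sub h1, by rwa [bilinTrace_sub, ← h2, sub_zero]⟩)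
    (fun z hz => sub_nonpos.2 (hle z hz)) y hy
  exact sub_nonpos.1 this

/-- The outer function in the definition of `profileTransform`. -/
noncomputable def profileOuter (n : ℕ) (M : ℝ → ℝ) (t : ℝ) : ℝ :=
  if n = 2 then Real.log (M t) else M t ^ (((n : ℝ) - 2) / n)

/-- The constant in the derivative of `profileOuter`. -/
noncomputable def profileConst (n : ℕ) : ℝ := if n = 2 then 1 else ((n : ℝ) - 2) / n

theorem profileConst_nonneg (hn : 2 ≤ n) : 0 ≤ profileConst n := by
  rw [profileConst]
  split_ifs
  · exact zero_le_one
  · have : (2 : ℝ) ≤ n := by exact_mod_cast hn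
    exact div_nonneg (by linarith) (by positivity)

variable {M : ℝ → ℝ}

/-- The logarithm plays the role of the power with exponent `0`, so both cases share one derivative
up to the constant. -/
theorem IsProfile.hasDerivAt_profileOuter (hn : 2 ≤ n) (hM : IsProfile n M) {t : ℝ} (ht : 0 < t) :
    HasDerivAt (profileOuter n M) (profileConst n * (M t ^ (-(2 : ℝ) / n) - 1)) t := by
  have hpos := hM.pos hn ht
  have hd := hM.hasDerivAt ht
  have hn0 : (n : ℝ) ≠ 0 := by positivity
  have hmul : M t ^ (-(2 : ℝ) / n) * (1 - M t ^ ((2 : ℝ) / n)) = M t ^ (-(2 : ℝ) / n) - 1 := by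
    rw [mul_sub, mul_one, ← Real.rpow_add hpos, neg_div, neg_add_cancel, Real.rpow_zero]
  by_cases h2 : n = 2
  · have hfun : profileOuter n M = fun t => Real.log (M t) := by
      ext t
      simp [profileOuter, h2]
    rw [hfun, profileConst, if_pos h2, ← hmul, one_mul]
    refine (hd.log hpos.ne').congr_deriv ?_
    subst h2
    rw [div_eq_mul_inv, mul_comm, ← Real.rpow_neg_one]
    norm_num
  · have hfun : profileOuter n M = fun t => M t ^ (((n : ℝ) - 2) / n) := by
      ext t
      simp [profileOuter, h2]
    rw [hfun, profileConst, if_neg h2, ← hmul]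
    refine (hd.rpow_const (Or.inl hpos.ne')).congr_deriv ?_
    have : ((n : ℝ) - 2) / n - 1 = -(2 : ℝ) / n := by
      field_simp
      ring
    rw [this]
    ring

theorem IsProfile.hasDerivAt_profileOuter_deriv (hn : 2 ≤ n) (hM : IsProfile n M) {t : ℝ}
    (ht : 0 < t) :
    HasDerivAt (fun t => profileConst n * (M t ^ (-(2 : ℝ) / n) - 1))
      (profileConst n * (-(2 : ℝ) / n * (M t ^ (-(2 : ℝ) / n) / M t) *
        (1 - M t ^ ((2 : ℝ) / n)))) t := by
  have hpos := hM.pos hn ht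
  refine ((((hM.hasDerivAt ht).rpow_const (Or.inl hpos.ne')).sub_const 1).const_mul
    (profileConst n)).congr_deriv ?_
  rw [Real.rpow_sub_one hpos.ne']
  ring

variable {ρ : EuclideanSpace ℝ (Fin n) → ℝ}

theorem IsDensity.potentialV_pos (hn : 0 < n) (hρ : IsDensity ρ) (h0 : ¬ρ =ᵐ[volume] 0)
    {x : EuclideanSpace ℝ (Fin n)} (hx : x ∉ tsupport ρ) : 0 < potentialV ρ x := by
  have hi : Integrable fun ζ => ρ ζ / ‖x - ζ‖ ^ n := by
    have := hρ.integrable_smul (continuousOn_sub_kernel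
      (continuousOn_norm_sq_rpow (E := EuclideanSpace ℝ (Fin n)) (-(n : ℝ) / 2)) hx)
    simpa only [sq_rpow_neg_half _ (norm_nonneg _), smul_eq_mul, ← div_eq_mul_inv] using this
  have hnn : ∀ ζ, 0 ≤ ρ ζ / ‖x - ζ‖ ^ n := fun ζ => div_nonneg (hρ.nonneg ζ) (by positivity)
  have hω := sphereArea_pos hn
  refine mul_pos (by positivity) ((integral_nonneg hnn).lt_of_ne fun h => h0 ?_)
  have hae := (integral_eq_zero_iff_of_nonneg hnn hi).1 h.symm
  filter_upwards [hae] with ζ hζ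
  by_contra hne
  have hxζ : x - ζ ≠ 0 := fun h => hne
    (image_eq_zero_of_notMem_tsupport ((sub_eq_zero.1 h) ▸ hx))
  exact div_ne_zero hne (pow_ne_zero _ (norm_ne_zero_iff.2 hxζ)) hζ

theorem IsDensity.exists_hasHessianAt_profileTransform (hn : 2 ≤ n) (hρ : IsDensity ρ)
    (hM : IsProfile n M) {x : EuclideanSpace ℝ (Fin n)} (hx : x ∉ tsupport ρ)
    (hV : 0 < potentialV ρ x) :
    ∃ F' B, HasHessianAt (profileTransform M ρ) F' B x ∧ 0 ≤ bilinTrace B := by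
  have hn0 : 0 < n := by omega
  obtain ⟨V', B, hB, hV', htr⟩ := hρ.exists_hasHessianAt_potentialV hx
  have hcomp := hB.comp (φ := profileOuter n M)
    (by
      filter_upwards [lt_mem_nhds hV] with t ht
      exact hM.hasDerivAt_profileOuter hn ht)
    (hM.hasDerivAt_profileOuter_deriv hn hV)
  refine ⟨_, _, hcomp, ?_⟩
  have hsm : ∀ (a : ℝ) (w : EuclideanSpace ℝ (Fin n)),
      (a • innerSL ℝ w).smulRight (innerSL ℝ w) = a • (innerSL ℝ w).smulRight (innerSL ℝ w) := by
    intro a w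
    ext s t
    simp
    ring
  rw [bilinTrace_add, bilinTrace_smul, htr, hV', hsm, bilinTrace_smul, bilinTrace_smulRight,
    real_inner_self_eq_norm_sq, norm_smul]
  have hkey := hρ.gradient_ineq hn hx hM hV
  have hm0 := hM.pos hn hV
  have hm1 := hM.lt_one hn hV.le
  set m := M (potentialV ρ x)
  set A := ‖potentialGrad ρ x‖
  set J := potentialLap ρ x
  have hω := sphereArea_pos hn0
  have hn' : (0 : ℝ) < n := by positivity
  have hc0 := profileConst_nonneg hn
  set κ := (n : ℝ) / sphereArea n
  have hκ : 0 < κ := by positivity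
  set k := m ^ (-(2 : ℝ) / n)
  set l := m ^ ((2 : ℝ) / n)
  have hk0 : 0 < k := by positivity
  have hl1 : l < 1 := Real.rpow_lt_one hm0.le hm1 (by positivity)
  have hkl : k - 1 = k * (1 - l) := by
    have : k * l = 1 := by
      rw [← Real.rpow_add hm0, neg_div, neg_add_cancel, Real.rpow_zero]
    linarith
  rw [hkl, Real.norm_of_nonneg (by positivity)]
  -- The chain-rule Laplacian factors so that its sign is that of the defect in the gradient
  -- estimate.
  have hfin : profileConst n * (k * (1 - l)) * (2 * n * κ * J) +
      profileConst n * (-(2 : ℝ) / n * (k / m) * (1 - l)) * (n * κ * A) ^ 2 =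
      profileConst n * k * (1 - l) * (2 * n * κ) / m * (m * J - κ * A ^ 2) := by
    field_simp
    ring
  rw [hfin]
  have h1 : 0 ≤ 1 - l := by linarith
  have h2 : 0 ≤ m * J - κ * A ^ 2 := by linarith
  positivity

theorem subharmonicOn_profileTransform (hn : 2 ≤ n) (hM : IsProfile n M) (hρ : IsDensity ρ)
    (h0 : n = 2 → ¬ρ =ᵐ[volume] 0) : SubharmonicOn (profileTransform M ρ) (tsupport ρ)ᶜ := by
  have hn0 : 0 < n := by omega
  refine subharmonicOn_of_hessian_trace_nonneg hn0 fun x hx => ?_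
  by_cases hz : ρ =ᵐ[volume] 0
  -- For a null density `V = 0` and `M 0 = 0`; the exponent is positive, so `F` vanishes
  -- identically.
  · have hn2 : n ≠ 2 := fun h => h0 h hz
    have hV : ∀ y, potentialV ρ y = 0 := fun y => by
      rw [potentialV_congr_ae hz]
      simp [potentialV]
    have hn3 : (2 : ℝ) < n := by exact_mod_cast (by omega : 2 < n)
    have hexp : ((n : ℝ) - 2) / n ≠ 0 := div_ne_zero (by linarith) (by positivity)
    have hF : profileTransform M ρ = fun _ => 0 := by
      ext y
      rw [profileTransform, if_neg hn2, hV, hM.1, Real.zero_rpow hexp]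
    rw [hF]
    exact ⟨fun _ => 0, 0, ⟨Eventually.of_forall fun y => hasFDerivAt_const _ _,
      hasFDerivAt_const _ _⟩, by simp [bilinTrace]⟩
  · exact hρ.exists_hasHessianAt_profileTransform hn hM hx (hρ.potentialV_pos hn0 hz hx)

/-- The profile inverts `profileTime`, so `M(V) = (R/‖y - c‖)^n`, and the outer function turns this
into a fundamental solution with pole `c`, up to constants. -/
theorem harmonicOnNhd_profileTransform_ball (hn : 2 ≤ n) (hM : IsProfile n M)
    (c : EuclideanSpace ℝ (Fin n)) {R : ℝ} (hR : 0 < R) {B : Set (EuclideanSpace ℝ (Fin n))}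
    (hB : B = ball c R ∨ B = closedBall c R) :
    HarmonicOnNhd (profileTransform M (B.indicator fun _ => (1 : ℝ))) (closedBall c R)ᶜ := by
  have hn0 : 0 < n := by omega
  have hn' : (n : ℝ) ≠ 0 := by positivity
  have hV : potentialV (B.indicator fun _ => (1 : ℝ)) =
      potentialV ((ball c R).indicator fun _ => (1 : ℝ)) := by
    rcases hB with rfl | rfl
    · rfl
    · exact potentialV_indicator_closedBall c hR
  have hval : ∀ y ∈ (closedBall c R)ᶜ, M (potentialV (B.indicator fun _ => (1 : ℝ)) y) =
      R ^ n * (‖y - c‖ ^ 2) ^ (-(n : ℝ) / 2) := by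
    intro y hy
    have hRy : R < ‖y - c‖ := by simpa [dist_eq_norm] using hy
    have hlt : (R / ‖y - c‖) ^ n < 1 :=
      pow_lt_one₀ (by positivity) ((div_lt_one (hR.trans hRy)).2 hRy) hn0.ne'
    rw [hV, potentialV_indicator_ball hn0 hR hRy, hM.apply_profileTime hn (by positivity) hlt,
      sq_rpow_neg_half _ (norm_nonneg _), div_pow, div_eq_mul_inv]
  intro x hx
  have hopen : IsOpen (closedBall c R)ᶜ := isClosed_closedBall.isOpen_compl
  have hne : ∀ y ∈ (closedBall c R)ᶜ, y ≠ c := by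
    rintro y hy rfl
    exact hy (mem_closedBall_self hR.le)
  by_cases h2 : n = 2
  · have heq : profileTransform M (B.indicator fun _ => (1 : ℝ)) =ᶠ[𝓝 x]
        (fun _ => Real.log (R ^ n)) - fun y => Real.log (‖y - c‖ ^ 2) := by
      filter_upwards [hopen.mem_nhds hx] with y hy
      have hq : 0 < ‖y - c‖ ^ 2 := by
        have := norm_pos_iff.2 (sub_ne_zero.2 (hne y hy))
        positivity
      rw [profileTransform, if_pos h2, hval y hy, Real.log_mul (by positivity) (by positivity),
        Real.log_rpow hq, Pi.sub_apply]
      have hn2 : (n : ℝ) = 2 := by exact_mod_cast h2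
      rw [hn2]
      ring
    rw [harmonicAt_congr_nhds heq]
    exact (harmonicAt_const _).sub
      (harmonicAt_log_norm_sub_sq (by rw [finrank_euclideanSpace_fin, h2]) (hne x hx))
  · have heq : profileTransform M (B.indicator fun _ => (1 : ℝ)) =ᶠ[𝓝 x]
        (R ^ n) ^ (((n : ℝ) - 2) / n) • fun y => (‖y - c‖ ^ 2) ^
          (1 - (Module.finrank ℝ (EuclideanSpace ℝ (Fin n)) : ℝ) / 2) := by
      filter_upwards [hopen.mem_nhds hx] with y hy
      rw [profileTransform, if_neg h2, hval y hy, Real.mul_rpow (by positivity) (by positivity),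
        ← Real.rpow_mul (by positivity), Pi.smul_apply, smul_eq_mul, finrank_euclideanSpace_fin]
      congr 2
      field_simp
      ring
    rw [harmonicAt_congr_nhds heq]
    exact (harmonicAt_norm_sub_sq_rpow (hne x hx)).const_smul

end Subharmonic

theorem theorem1p2 (n : ℕ) (hn : 2 ≤ n) :
    (∃ M : ℝ → ℝ, IsProfile n M) ∧
    ∀ M : ℝ → ℝ, IsProfile n M →
      (∀ ρ : EuclideanSpace ℝ (Fin n) → ℝ, IsDensity ρ → (n = 2 → ¬ ρ =ᵐ[volume] 0) →
        SubharmonicOn (profileTransform M ρ) (tsupport ρ)ᶜ) ∧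
      (∀ (c : EuclideanSpace ℝ (Fin n)) (R : ℝ), 0 < R →
        ∀ B : Set (EuclideanSpace ℝ (Fin n)), (B = ball c R ∨ B = closedBall c R) →
          InnerProductSpace.HarmonicOnNhd
            (profileTransform M (B.indicator fun _ => (1 : ℝ))) (closedBall c R)ᶜ) := by
  obtain ⟨M₀, hM₀, -⟩ := exists_profile hn
  exact ⟨⟨M₀, hM₀⟩, fun M hM => ⟨fun ρ hρ h0 => subharmonicOn_profileTransform hn hM hρ h0,
    fun c R hR B hB => harmonicOnNhd_profileTransform_ball hn hM c hR hB⟩⟩
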